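/- **Setting.** Let $\Omega$ be a finite set with $n$ elements, $k\ge 1$ an integer, and $f:2^\Omega\to\mathbb R_{\ge 0}$ a submodular function with $f(\emptyset)=0$ (not necessarily monotone). For $X\subseteq\Omega$ put $\mathrm{OPT}(X)=\max\{f(S): S\subseteq X,\ |S|\le k\}$ and $\mathrm{OPT}=\mathrm{OPT}(\Omega)$. In the secretary setting the elements of $\Omega$ arrive in uniformly random order; the algorithm knows $n$, must irrevocably select or reject each element on arrival, may query $f$ only on sets of elements that have already arrived, and may select at most $k$ elements. A (randomized) *$\rho_{\rm off}$-approximate offline algorithm* outputs, for each such $f$ and each $X\subseteq\Omega$, querying $f$ only on subsets of $X$, a set $A\subseteq X$ with $|A|\le k$ and $\mathbb E f(A)\ge \mathrm{OPT}(X)/\rho_{\rm off}$. A (randomized) *$\rho_{\rm on}$-approximate advice-taking online algorithm* receives a number $Z\ge0$ and then, in an arbitrary order, the elements of a set $X\subseteq\Omega$; it irrevocably selects at most $k$ of them, querying $f$ only on elements that have arrived, and the selected set $A$ satisfies $\mathbb E f(A)\ge Z/\rho_{\rm on}$ whenever $Z\le\mathrm{OPT}(X)$. **Algorithm SubmodularSecretaries.**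 Flip a fair coin. If heads, run Dynkin's algorithm on the values $f(\{x\})$ (ties broken by a fixed linear order on $\Omega$): observe the first $\lfloor n/e\rfloor$ elements, then select the first later element that is larger than all of them, if any. If tails, draw $m\sim\mathrm{Bin}(n,\tfrac12)$, run the offline algorithm on the set of the first $m$ elements to get $A_1$, run the advice-taking online algorithm with $Z=f(A_1)$ on the remaining elements, and return its output. **Threshold algorithm.** With inputs $(\tau,k)$ it selects each arriving element whose marginal value with respect to the current selection is at least $\tau$, up to at most $k$ elements. The *advice-taking threshold algorithm* with guess $Z$ sets $\tau=Z/(7k)$ and returns a uniformly random one of $S_1,S_1',S_2$, where $S_1$ is the output of the threshold algorithm on the stream, $S_1'$ is a uniformly random subset of $S_1$, and $S_2$ is the output of the threshold algorithm on the stream without the elements of $S_1$. **Theorem.** Let $\rho_{\rm off},\rho_{\rm on}\ge1$. 1. For every $\rho_{\rm off}$-approximate offline algorithm and every $\rho_{\rm on}$-approximate advice-taking online algorithm, SubmodularSecretaries is a valid algorithm for the secretary setting (online, and selecting at most $k$ elements), and it is an $O(1)$-approximation: for every $f$ as above and all real $c\ge1$, $d>0$, its output $A$ satisfies $$\mathbb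 E f(A)\ \ge\ \min\Big(\frac{1}{8\rho_{\rm off}\rho_{\rm on}}\Big(1-\frac1{d^2}\Big)\Big(1-\frac{d}{\sqrt c}\Big),\ \frac1{2ce}\Big)\cdot\mathrm{OPT},$$ the expectation being over the arrival order and the algorithm's random choices. 2. For every $\rho_{\rm off}$-approximate offline algorithm, SubmodularSecretaries with the advice-taking threshold algorithm as its online algorithm is a valid algorithm for the secretary setting, and the bound of part 1 holds for it with $\rho_{\rm on}=21$. If moreover $\rho_{\rm off}\le 6.5$, then $\mathbb E f(A)\ge \mathrm{OPT}/1417$ for every $f$ as above. -/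

import Mathlib

namespace SubmodSec

/-- The set functions under consideration: non-negative, submodular, not necessarily monotone,
and zero at the empty set. -/
structure IsValuation {Ω : Type*} [DecidableEq Ω] (f : Finset Ω → ℝ) : Prop where
  nonneg : ∀ S, 0 ≤ f S
  empty : f ∅ = 0
  submodular : ∀ S T, f (S ∪ T) + f (S ∩ T) ≤ f S + f T

/-- `opt f k X` is the maximum of `f S` over all `S ⊆ X` with at most `k` elements. -/
noncomputable def opt {Ω : Type*} [DecidableEq Ω] (f : Finset Ω → ℝ) (k : ℕ) (X : Finset Ω) : ℝ :=
  (X.powerset.filter fun S => S.card ≤ k).sup' ⟨∅, by simp⟩ f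

/-- The expected value of `f` at a random subset of the (finite) universe with law `p`. -/
noncomputable def expect {Ω : Type*} [Fintype Ω] [DecidableEq Ω]
    (p : PMF (Finset Ω)) (f : Finset Ω → ℝ) : ℝ :=
  ∑ S : Finset Ω, (p S).toReal * f S

/-- A randomized offline algorithm maps a value oracle and a finite ground set to the law of its
output. It is a `ρ`-approximation under the cardinality constraint `k` if its output is always
feasible, it consults the oracle only on subsets of the ground set, and on every instance the
expected value of its output is at least a `1 / ρ` fraction of the optimum. -/
structure IsOfflineApprox {Ω : Type*} [Fintype Ω] [DecidableEq Ω] (k : ℕ) (ρ : ℝ)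
    (Off : (Finset Ω → ℝ) → Finset Ω → PMF (Finset Ω)) : Prop where
  feasible : ∀ f, IsValuation f → ∀ X, ∀ S ∈ (Off f X).support, S ⊆ X ∧ S.card ≤ k
  oracle : ∀ f g, IsValuation f → IsValuation g → ∀ X, (∀ S ⊆ X, f S = g S) → Off f X = Off g X
  approx : ∀ f, IsValuation f → ∀ X, opt f k X / ρ ≤ expect (Off f X) f

/-- A randomized advice-taking algorithm maps a guess `Z` of the optimum, a value oracle and a
stream of distinct elements to the law of its output. It is an online `ρ`-approximation under the
cardinality constraint `k` if its output is always feasible, its irrevocable selection among the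
elements that have arrived so far depends (in law) only on those elements and on the values of
their subsets, and, in whatever order the elements arrive, it obtains an expected value of
at least `Z / ρ` whenever `Z` is at most the optimum of the stream. -/
structure IsAdviceApprox {Ω : Type*} [Fintype Ω] [DecidableEq Ω] (k : ℕ) (ρ : ℝ)
    (On : ℝ → (Finset Ω → ℝ) → List Ω → PMF (Finset Ω)) : Prop where
  feasible : ∀ Z, 0 ≤ Z → ∀ f, IsValuation f → ∀ l : List Ω, l.Nodup →
    ∀ S ∈ (On Z f l).support, S ⊆ l.toFinset ∧ S.card ≤ k
  online : ∀ Z, 0 ≤ Z → ∀ f g, IsValuation f → IsValuation g → ∀ l₁ l₂ : List Ω,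
    (l₁ ++ l₂).Nodup → (∀ S ⊆ l₁.toFinset, f S = g S) →
    (On Z f (l₁ ++ l₂)).map (fun S => S ∩ l₁.toFinset) = On Z g l₁
  approx : ∀ f, IsValuation f → ∀ l : List Ω, l.Nodup →
    ∀ Z, 0 ≤ Z → Z ≤ opt f k l.toFinset → Z / ρ ≤ expect (On Z f l) f

/-- A randomized algorithm for the secretary setting with cardinality constraint `k`: its output
is always feasible, and its irrevocable selection among the elements that have arrived so far
depends (in law) only on the length of the stream, on the elements that have arrived and on the
values of their subsets. -/
structure IsSecretaryAlgorithm {Ω : Type*} [DecidableEq Ω] (k : ℕ)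
    (A : (Finset Ω → ℝ) → List Ω → PMF (Finset Ω)) : Prop where
  feasible : ∀ f, IsValuation f → ∀ l : List Ω, l.Nodup →
    ∀ S ∈ (A f l).support, S ⊆ l.toFinset ∧ S.card ≤ k
  online : ∀ f g, IsValuation f → IsValuation g → ∀ l₁ l₂ l₂' : List Ω,
    (l₁ ++ l₂).Nodup → (l₁ ++ l₂').Nodup → l₂.length = l₂'.length →
    (∀ S ⊆ l₁.toFinset, f S = g S) →
    (A f (l₁ ++ l₂)).map (fun S => S ∩ l₁.toFinset)
      = (A g (l₁ ++ l₂')).map (fun S => S ∩ l₁.toFinset)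

/-- The threshold algorithm with inputs `(τ, k)`: select each arriving element whose marginal
value is at least `τ`, up to a maximum of `k` elements. -/
noncomputable def threshold {Ω : Type*} [DecidableEq Ω] (f : Finset Ω → ℝ) (τ : ℝ) (k : ℕ)
    (l : List Ω) : Finset Ω :=
  l.foldl (fun S x => if S.card < k ∧ τ ≤ f (insert x S) - f S then insert x S else S) ∅

/-- The advice-taking threshold algorithm with guess `Z`: with `τ = Z / (7 k)`, let `S₁` be the
output of the threshold algorithm on the stream, `S₁'` a uniformly random subset of `S₁`, and `S₂`
the output of the threshold algorithm on the stream without the elements of `S₁`. Return a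
uniformly random one of `S₁`, `S₁'`, `S₂`. -/
noncomputable def thresholdAdvice {Ω : Type*} [DecidableEq Ω] (k : ℕ)
    (Z : ℝ) (f : Finset Ω → ℝ) (l : List Ω) : PMF (Finset Ω) :=
  let τ := Z / (7 * k)
  let S₁ := threshold f τ k l
  let S₂ := threshold f τ k (l.filter fun x => x ∉ S₁)
  (PMF.uniformOfFintype (Fin 3)).bind
    ![PMF.pure S₁, PMF.uniformOfFinset S₁.powerset ⟨∅, by simp⟩, PMF.pure S₂]

/-- Dynkin's algorithm on the singleton values: observe the first `⌊n / e⌋` elements and select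
the next element that is larger than all of them (nothing, if there is none). Ties are
broken by the linear order on the universe. -/
noncomputable def dynkin {Ω : Type*} [LinearOrder Ω] (f : Finset Ω → ℝ) (l : List Ω) : Finset Ω :=
  let r := ⌊(l.length : ℝ) / Real.exp 1⌋₊
  match (l.drop r).find? (fun x => ∀ y ∈ l.take r, toLex (f {y}, y) < toLex (f {x}, x)) with
  | some x => {x}
  | none => ∅

set_option linter.deprecated false in
/-- The algorithm `SubmodularSecretaries`, with offline algorithm `Off` and advice-taking online
algorithm `On`, on the stream `l`. -/
noncomputable def submodularSecretaries {Ω : Type*} [LinearOrder Ω]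
    (Off : (Finset Ω → ℝ) → Finset Ω → PMF (Finset Ω))
    (On : ℝ → (Finset Ω → ℝ) → List Ω → PMF (Finset Ω))
    (f : Finset Ω → ℝ) (l : List Ω) : PMF (Finset Ω) :=
  (PMF.uniformOfFintype Bool).bind fun heads =>
    if heads then PMF.pure (dynkin f l)
    else
      (PMF.binomial (1 / 2) (by norm_num) l.length).bind fun m =>
        (Off f (l.take m).toFinset).bind fun A₁ =>
          On (f A₁) f (l.drop m)

/-- A uniformly random order of the elements of the universe. -/
noncomputable def randomOrder (Ω : Type*) [Fintype Ω] [DecidableEq Ω] : PMF (List Ω) :=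
  (PMF.uniformOfFintype (Equiv.Perm Ω)).map fun π => (Finset.univ : Finset Ω).toList.map π

/-- The expected value obtained by the algorithm `A` when all elements of the universe arrive in
uniformly random order. -/
noncomputable def secretaryValue {Ω : Type*} [Fintype Ω] [DecidableEq Ω]
    (A : (Finset Ω → ℝ) → List Ω → PMF (Finset Ω)) (f : Finset Ω → ℝ) : ℝ :=
  expect ((randomOrder Ω).bind (A f)) f

end SubmodSec

/-! Fix `c` and distinguish whether some singleton is worth more than OPT/c. If so, the heads branch
suffices: Dynkin's rule picks the best singleton with probability at least 1/e for every n
(`factorial_le_exp_mul_card`, `le_sum_dynkin`), which gives OPT/(2ce).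

Otherwise the tails branch suffices. The first Bin(n, 1/2) elements of a random order form a
uniformly random set X (`sum_ofFn_take`). An optimal set C carries additive weights lying below `f`
on subsets of C (`exists_weights`), so the optima of X and of its complement are at least OPT/2
minus half of a random signed sum of these weights. No weight exceeds OPT/c, so the variance of that
sum is at most OPT²/c, and Cauchy–Schwarz bounds the expected smaller optimum below by (1 - 1/√c)
OPT/2 (`sum_min_opt_ge`). By the symmetry between X and its complement, half of this is collected
where OPT(X) is the smaller one (`sum_ite_le_compl_ge`). There the advice f(A₁) never exceeds the
optimum of the remaining stream, so the online guarantee applies for each outcome A₁ and then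
averages (`le_expect_splitRun`). Three factors 1/2 make up the 1/8. The resulting factor 1 - 1/√c
dominates the Chebyshev-type factor of the theorem (`chebyshev_factor_le`).

For the threshold algorithm (`thresholdAdvice_approx`), a full selection is worth kτ = Z/7. If
neither run fills up, no element of C has a large marginal value over the runs that rejected it, and
submodularity bounds f(C) in terms of S₁, S₂ and a random subset of S₁. The last is needed because
`f` need not be monotone and C may overlap S₁.

Validity as an online algorithm is an equality of laws: the output restricted to a prefix is
determined in law by the prefix and the stream length. -/

namespace SubmodSec

/-! ### Expectations of set functions under finite laws. -/

section Expect

variable {Ω : Type*} [Fintype Ω] [DecidableEq Ω]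

lemma expect_bind {α : Type*} [Fintype α] (p : PMF α) (q : α → PMF (Finset Ω))
    (f : Finset Ω → ℝ) :
    expect (p.bind q) f = ∑ a, (p a).toReal * expect (q a) f := by
  unfold expect
  have h (S : Finset Ω) : (p.bind q S).toReal = ∑ a, (p a).toReal * (q a S).toReal := by
    rw [PMF.bind_apply, tsum_fintype, ENNReal.toReal_sum fun a _ =>
      ENNReal.mul_ne_top (p.apply_ne_top a) ((q a).apply_ne_top S)]
    simp only [ENNReal.toReal_mul]
  simp only [h, Finset.sum_mul, Finset.mul_sum, mul_assoc]
  exact Finset.sum_comm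

lemma expect_pure (S : Finset Ω) (f : Finset Ω → ℝ) : expect (PMF.pure S) f = f S := by
  simp [expect, PMF.pure_apply, apply_ite ENNReal.toReal]

lemma expect_nonneg (p : PMF (Finset Ω)) {f : Finset Ω → ℝ} (hf : ∀ S, 0 ≤ f S) :
    0 ≤ expect p f :=
  Finset.sum_nonneg fun S _ => mul_nonneg ENNReal.toReal_nonneg (hf S)

lemma expect_uniformOfFinset (s : Finset (Finset Ω)) (hs : s.Nonempty) (f : Finset Ω → ℝ) :
    expect (PMF.uniformOfFinset s hs) f = (s.card : ℝ)⁻¹ * ∑ S ∈ s, f S := by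
  simp [expect, PMF.uniformOfFinset_apply, apply_ite ENNReal.toReal, ite_mul, Finset.mul_sum]

end Expect

/-! ### The constrained optimum and diminishing marginal values. -/

section Opt

variable {Ω : Type*} [DecidableEq Ω]

lemma exists_opt (f : Finset Ω → ℝ) (k : ℕ) (X : Finset Ω) :
    ∃ S ⊆ X, S.card ≤ k ∧ f S = opt f k X := by
  obtain ⟨S, hS, h⟩ := Finset.exists_mem_eq_sup' (s := X.powerset.filter fun S => S.card ≤ k)
    ⟨∅, by simp⟩ f
  simp only [Finset.mem_filter, Finset.mem_powerset] at hS
  exact ⟨S, hS.1, hS.2, h.symm⟩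

lemma le_opt (f : Finset Ω → ℝ) {k : ℕ} {X S : Finset Ω} (hS : S ⊆ X) (hk : S.card ≤ k) :
    f S ≤ opt f k X :=
  Finset.le_sup' f (by simp [hS, hk])

lemma IsValuation.opt_nonneg {f : Finset Ω → ℝ} (hf : IsValuation f) (k : ℕ) (X : Finset Ω) :
    0 ≤ opt f k X :=
  hf.empty ▸ le_opt f (Finset.empty_subset X) (by simp)

/-- Diminishing marginal values. -/
lemma IsValuation.marginal_le {f : Finset Ω → ℝ} (hf : IsValuation f) {S T : Finset Ω}
    (hST : S ⊆ T) {x : Ω} (hx : x ∉ T) :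
    f (insert x T) - f T ≤ f (insert x S) - f S := by
  have h := hf.submodular (insert x S) T
  have h1 : insert x S ∪ T = insert x T := by
    rw [Finset.insert_union, Finset.union_eq_right.2 hST]
  have h2 : insert x S ∩ T = S := by
    rw [Finset.insert_inter_of_notMem hx, Finset.inter_eq_left.2 hST]
  rw [h1, h2] at h
  linarith

/-- Adding the elements of `C` one at a time, each marginal value is at most the one over `S` alone.
-/
lemma IsValuation.union_le_of_marginal_le {f : Finset Ω → ℝ} (hf : IsValuation f) {τ : ℝ}
    (S C : Finset Ω) (h : ∀ x ∈ C, x ∉ S → f (insert x S) - f S ≤ τ) :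
    f (S ∪ C) ≤ f S + (C \ S).card * τ := by
  induction C using Finset.induction_on with
  | empty => simp
  | insert x C hx ih =>
    have ih := ih fun y hy => h y (Finset.mem_insert_of_mem hy)
    by_cases hxS : x ∈ S
    · rwa [Finset.insert_sdiff_of_mem _ hxS, Finset.union_insert,
        Finset.insert_eq_of_mem (Finset.mem_union_left _ hxS)]
    · rw [Finset.insert_sdiff_of_notMem _ hxS, Finset.card_insert_of_notMem (by simp [hx]),
        Finset.union_insert]
      have h1 := hf.marginal_le (Finset.subset_union_left : S ⊆ S ∪ C) (x := x) (by simp [hx, hxS])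
      have h2 := h x (Finset.mem_insert_self _ _) hxS
      push_cast
      linarith

end Opt

/-! ### The deterministic threshold algorithm. -/

section Threshold

variable {Ω : Type*} [DecidableEq Ω]

lemma threshold_concat (f : Finset Ω → ℝ) (τ : ℝ) (k : ℕ) (l : List Ω) (x : Ω) :
    threshold f τ k (l ++ [x]) =
      if (threshold f τ k l).card < k ∧
        τ ≤ f (insert x (threshold f τ k l)) - f (threshold f τ k l)
      then insert x (threshold f τ k l) else threshold f τ k l := by
  rw [threshold, List.foldl_append]
  rfl

lemma threshold_subset (f : Finset Ω → ℝ) (τ : ℝ) (k : ℕ) (l : List Ω) :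
    threshold f τ k l ⊆ l.toFinset := by
  induction l using List.reverseRecOn with
  | nil => simp [threshold]
  | append_singleton l x ih =>
    have hl : l.toFinset ⊆ (l ++ [x]).toFinset := by simp
    rw [threshold_concat]
    split_ifs
    · exact Finset.insert_subset (by simp) (ih.trans hl)
    · exact ih.trans hl

lemma threshold_card_le (f : Finset Ω → ℝ) (τ : ℝ) (k : ℕ) (l : List Ω) :
    (threshold f τ k l).card ≤ k := by
  induction l using List.reverseRecOn with
  | nil => simp [threshold]
  | append_singleton l x ih =>
    rw [threshold_concat]
    split_ifs with h
    · exact (Finset.card_insert_le _ _).trans h.1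
    · exact ih

lemma card_mul_le_threshold {f : Finset Ω → ℝ} (hf : f ∅ = 0) {τ : ℝ} (hτ : 0 ≤ τ) (k : ℕ)
    (l : List Ω) : (threshold f τ k l).card * τ ≤ f (threshold f τ k l) := by
  induction l using List.reverseRecOn with
  | nil => simp [threshold, hf]
  | append_singleton l x ih =>
    rw [threshold_concat]
    split_ifs with h
    · have h1 : ((insert x (threshold f τ k l)).card : ℝ) ≤ (threshold f τ k l).card + 1 := by
        exact_mod_cast Finset.card_insert_le _ _
      nlinarith [h.2]
    · exact ih

lemma threshold_subset_append (f : Finset Ω → ℝ) (τ : ℝ) (k : ℕ) (l₁ l₂ : List Ω) :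
    threshold f τ k l₁ ⊆ threshold f τ k (l₁ ++ l₂) := by
  induction l₂ using List.reverseRecOn with
  | nil => simp
  | append_singleton l x ih =>
    rw [← List.append_assoc, threshold_concat]
    split_ifs
    · exact ih.trans (Finset.subset_insert _ _)
    · exact ih

/-- The final selection is not full, so the budget was never exhausted and `x` was rejected for its
small marginal value, which can only decrease as the selection grows. -/
lemma threshold_marginal_le {f : Finset Ω → ℝ} (hf : IsValuation f) {τ : ℝ} {k : ℕ}
    {l : List Ω} (hk : (threshold f τ k l).card < k) {x : Ω} (hx : x ∈ l)
    (hxS : x ∉ threshold f τ k l) :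
    f (insert x (threshold f τ k l)) - f (threshold f τ k l) ≤ τ := by
  obtain ⟨l₁, l₂, rfl⟩ := List.append_of_mem hx
  have h1 : threshold f τ k (l₁ ++ [x]) ⊆ threshold f τ k (l₁ ++ x :: l₂) := by
    simpa using threshold_subset_append f τ k (l₁ ++ [x]) l₂
  have h2 : threshold f τ k l₁ ⊆ threshold f τ k (l₁ ++ x :: l₂) :=
    threshold_subset_append f τ k l₁ (x :: l₂)
  have h3 := hf.marginal_le h2 hxS
  refine h3.trans (le_of_not_ge fun h4 => hxS (h1 ?_))
  rw [threshold_concat, if_pos ⟨(Finset.card_le_card h2).trans_lt hk, h4⟩]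
  exact Finset.mem_insert_self _ _

lemma threshold_congr {f g : Finset Ω → ℝ} {l : List Ω} (h : ∀ S ⊆ l.toFinset, f S = g S)
    (τ : ℝ) (k : ℕ) : threshold f τ k l = threshold g τ k l := by
  induction l using List.reverseRecOn with
  | nil => simp [threshold]
  | append_singleton l x ih =>
    have hl : l.toFinset ⊆ (l ++ [x]).toFinset := by simp
    have ih := ih fun S hS => h S (hS.trans hl)
    have hg := (threshold_subset g τ k l).trans hl
    rw [threshold_concat, threshold_concat, ih, h _ hg,
      h _ (Finset.insert_subset (by simp) hg)]

lemma threshold_append_inter (f : Finset Ω → ℝ) (τ : ℝ) (k : ℕ) {l₁ l₂ : List Ω}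
    (h : l₁.Disjoint l₂) :
    threshold f τ k (l₁ ++ l₂) ∩ l₁.toFinset = threshold f τ k l₁ := by
  induction l₂ using List.reverseRecOn with
  | nil => simpa using threshold_subset f τ k l₁
  | append_singleton l x ih =>
    rw [List.disjoint_append_right] at h
    have hx : x ∉ l₁.toFinset := by simpa using h.2
    rw [← List.append_assoc, threshold_concat]
    split_ifs
    · rw [Finset.insert_inter_of_notMem hx, ih h.1]
    · exact ih h.1

end Threshold

/-! ### The advice-taking threshold algorithm: ratio 21 and the online property. -/

section ThresholdAdvice

variable {Ω : Type*} [DecidableEq Ω]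

/-- The law of a uniformly random subset of `S`. -/
noncomputable def uniformSubset (S : Finset Ω) : PMF (Finset Ω) :=
  PMF.uniformOfFinset S.powerset (Finset.powerset_nonempty S)

lemma thresholdAdvice_eq (k : ℕ) (Z : ℝ) (f : Finset Ω → ℝ) (l : List Ω) :
    thresholdAdvice k Z f l = (PMF.uniformOfFintype (Fin 3)).bind
      ![PMF.pure (threshold f (Z / (7 * k)) k l),
        uniformSubset (threshold f (Z / (7 * k)) k l),
        PMF.pure (threshold f (Z / (7 * k)) k
          (l.filter fun x => x ∉ threshold f (Z / (7 * k)) k l))] :=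
  rfl

/-- Restricting a uniformly random subset of `S` to `T` gives a uniformly random subset of
`S ∩ T`. -/
lemma map_inter_uniformSubset (S T : Finset Ω) :
    (uniformSubset S).map (fun A => A ∩ T) = uniformSubset (S ∩ T) := by
  unfold uniformSubset
  ext A
  rw [PMF.map_apply, tsum_eq_sum (s := S.powerset.filter fun B => A = B ∩ T)]
  · rw [Finset.sum_congr rfl (g := fun _ => ((2 : ENNReal) ^ S.card)⁻¹), Finset.sum_const]
    · rw [PMF.uniformOfFinset_apply]
      split_ifs with hA
      · have hA' := Finset.mem_powerset.1 hA
        -- Each subset of `S ∩ T` has as many preimages as there are free choices on `S \ T`.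
        have hc : (S.powerset.filter fun B => A = B ∩ T).card = (S \ T).powerset.card := by
          refine Finset.card_bij' (fun B _ => B \ T) (fun B _ => A ∪ B) ?_ ?_ ?_ ?_ <;>
          · intro B hB
            simp only [Finset.mem_filter, Finset.mem_powerset] at hB ⊢
            grind
        have hS : S.card = (S \ T).card + (S ∩ T).card := (Finset.card_sdiff_add_card_inter S T).symm
        rw [hc, Finset.card_powerset, Finset.card_powerset, hS, pow_add, nsmul_eq_mul,
          ENNReal.mul_inv (by simp) (by simp), ← mul_assoc]
        push_cast
        rw [ENNReal.mul_inv_cancel (by simp) (by simp), one_mul]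
      · have : (S.powerset.filter fun B => A = B ∩ T) = ∅ := by
          rw [Finset.filter_eq_empty_iff]
          rintro B hB rfl
          exact hA (Finset.mem_powerset.2
            (Finset.inter_subset_inter_right (Finset.mem_powerset.1 hB)))
        simp [this]
    · intro B hB
      simp only [Finset.mem_filter] at hB
      rw [if_pos hB.2, PMF.uniformOfFinset_apply_of_mem _ hB.1]
      simp
  · intro B hB
    simp only [Finset.mem_filter, not_and] at hB
    split_ifs with h
    · exact PMF.uniformOfFinset_apply_of_notMem _ fun hB' => hB hB' h
    · rfl

/-- A uniformly random subset of `S` has at least a quarter of the value of any subset of `S`. -/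
lemma IsValuation.quarter_le_expect_uniformSubset [Fintype Ω] {f : Finset Ω → ℝ} (hf : IsValuation f)
    {S T : Finset Ω} (hT : T ⊆ S) :
    f T / 4 ≤ expect (uniformSubset S) f := by
  rw [uniformSubset, expect_uniformOfFinset]
  -- Toggling the elements of `T` is an involution of the subsets of `S`, so `R` and `symmDiff R T`
  -- have the same law; both unite to `R ∪ T`, which compares `f (R ∪ T)` with twice `f R` on
  -- average.
  have e1 : ∑ R ∈ S.powerset, f (symmDiff R T) = ∑ R ∈ S.powerset, f R := by
    refine Finset.sum_nbij' (fun R => symmDiff R T) (fun R => symmDiff R T) ?_ ?_ ?_ ?_ ?_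
    · intro R hR
      rw [Finset.mem_powerset] at hR ⊢
      intro x; have := @hR x; have := @hT x; rw [Finset.mem_symmDiff]; tauto
    · intro R hR
      rw [Finset.mem_powerset] at hR ⊢
      intro x; have := @hR x; have := @hT x; rw [Finset.mem_symmDiff]; tauto
    · intro R _; simp
    · intro R _; simp
    · intro R _; rfl
  have e2 : ∑ R ∈ S.powerset, f ((S \ R) ∪ T) = ∑ R ∈ S.powerset, f (R ∪ T) := by
    refine Finset.sum_nbij' (fun R => S \ R) (fun R => S \ R) ?_ ?_ ?_ ?_ ?_
    · intro R _; simp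
    · intro R _; simp
    · intro R hR; simpa using hR
    · intro R hR; simpa using hR
    · intro R _; rfl
  have h1 : ∑ R ∈ S.powerset, f (R ∪ T) ≤
      ∑ R ∈ S.powerset, (f R + f (symmDiff R T)) := by
    refine Finset.sum_le_sum fun R _ => ?_
    have h := hf.submodular R (symmDiff R T)
    have h' : R ∪ symmDiff R T = R ∪ T := by
      ext x; simp only [Finset.mem_union, Finset.mem_symmDiff]; tauto
    have := hf.nonneg (R ∩ symmDiff R T)
    rw [h'] at h
    linarith
  -- Complementation within `S` also preserves the law, and the two unions with `T` meet exactly in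
  -- `T`. This loses the second factor 2.
  have h2 : ∑ R ∈ S.powerset, f T ≤ ∑ R ∈ S.powerset, (f (R ∪ T) + f ((S \ R) ∪ T)) := by
    refine Finset.sum_le_sum fun R hR => ?_
    have h := hf.submodular (R ∪ T) ((S \ R) ∪ T)
    have h' : (R ∪ T) ∩ ((S \ R) ∪ T) = T := by
      ext x; simp only [Finset.mem_union, Finset.mem_inter, Finset.mem_sdiff]; tauto
    have := hf.nonneg ((R ∪ T) ∪ ((S \ R) ∪ T))
    rw [h'] at h
    linarith
  rw [Finset.sum_add_distrib, e1] at h1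
  rw [Finset.sum_add_distrib, e2, Finset.sum_const, nsmul_eq_mul] at h2
  have hc : (0 : ℝ) < S.powerset.card := by simp
  rw [inv_mul_eq_div, le_div_iff₀ hc]
  linarith

lemma expect_thresholdAdvice [Fintype Ω] (k : ℕ) (Z : ℝ) (f : Finset Ω → ℝ) (l : List Ω) :
    expect (thresholdAdvice k Z f l) f =
      (f (threshold f (Z / (7 * k)) k l)
        + expect (uniformSubset (threshold f (Z / (7 * k)) k l)) f
        + f (threshold f (Z / (7 * k)) k
          (l.filter fun x => x ∉ threshold f (Z / (7 * k)) k l))) / 3 := by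
  rw [thresholdAdvice_eq, expect_bind, Fin.sum_univ_three]
  simp [expect_pure]
  ring

lemma thresholdAdvice_approx [Fintype Ω] {k : ℕ} (hk : 1 ≤ k) {f : Finset Ω → ℝ}
    (hf : IsValuation f) (l : List Ω) {Z : ℝ} (hZ : 0 ≤ Z)
    (hZ' : Z ≤ opt f k l.toFinset) : Z / 21 ≤ expect (thresholdAdvice k Z f l) f := by
  rw [expect_thresholdAdvice]
  have hk' : (0 : ℝ) < k := by exact_mod_cast hk
  set τ := Z / (7 * k) with hτdef
  have hτ : 0 ≤ τ := by positivity
  have hkτ : k * τ = Z / 7 := by rw [hτdef]; field_simp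
  set S₁ := threshold f τ k l with hS₁
  set l' := l.filter fun x => x ∉ S₁ with hl'
  set S₂ := threshold f τ k l' with hS₂
  have h1 := hf.nonneg S₁
  have h2 := hf.nonneg S₂
  have hE := expect_nonneg (uniformSubset S₁) hf.nonneg
  suffices Z / 7 ≤ f S₁ + expect (uniformSubset S₁) f + f S₂ by
    linarith
  -- A full run alone is worth `k * τ = Z / 7`.
  rcases (threshold_card_le f τ k l).eq_or_lt with hc1 | hc1
  · have := card_mul_le_threshold hf.empty hτ k l
    rw [hc1, hkτ] at this
    linarith
  rcases (threshold_card_le f τ k l').eq_or_lt with hc2 | hc2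
  · have := card_mul_le_threshold hf.empty hτ k l'
    rw [hc2, hkτ] at this
    linarith
  obtain ⟨C, hCl, hCk, hC⟩ := exists_opt f k l.toFinset
  have hS₂l : S₂ ⊆ l'.toFinset := threshold_subset f τ k l'
  have hdisj : ∀ x ∈ S₂, x ∉ S₁ := fun x hx => by
    have := hS₂l hx
    simp only [hl', List.mem_toFinset, List.mem_filter, decide_eq_true_eq] at this
    exact this.2
  have b1 := hf.union_le_of_marginal_le (τ := τ) S₁ C fun x hx hxS =>
    threshold_marginal_le hf hc1 (List.mem_toFinset.1 (hCl hx)) hxS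
  have b2 := hf.union_le_of_marginal_le (τ := τ) S₂ (C \ S₁) fun x hx hxS => by
    rw [Finset.mem_sdiff] at hx
    exact threshold_marginal_le hf hc2
      (List.mem_filter.2 ⟨List.mem_toFinset.1 (hCl hx.1), by simpa using hx.2⟩) hxS
  have hc (D : Finset Ω) (hD : D ⊆ C) : D.card * τ ≤ Z / 7 := by
    rw [← hkτ]
    have : (D.card : ℝ) ≤ k := by exact_mod_cast (Finset.card_le_card hD).trans hCk
    exact mul_le_mul_of_nonneg_right this hτ
  have b3 := hc (C \ S₁) Finset.sdiff_subset
  have b4 := hc ((C \ S₁) \ S₂) (Finset.sdiff_subset.trans Finset.sdiff_subset)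
  -- With `E` the value of the random subset, the bounds combine to Z ≤ f S₁ + f S₂ + 4E + 2Z/7, so
  -- the three values sum to at least 5Z/28, more than the required Z/7.
  have b5 := hf.submodular (S₁ ∪ C) (S₂ ∪ (C \ S₁))
  have hint : (S₁ ∪ C) ∩ (S₂ ∪ (C \ S₁)) = C \ S₁ := by
    ext x
    have := hdisj x
    simp only [Finset.mem_union, Finset.mem_inter, Finset.mem_sdiff]
    tauto
  rw [hint] at b5
  have b6 := hf.nonneg ((S₁ ∪ C) ∪ (S₂ ∪ (C \ S₁)))
  have b7 := hf.submodular (C ∩ S₁) (C \ S₁)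
  rw [Finset.union_comm, Finset.sdiff_union_inter] at b7
  have b8 := hf.nonneg ((C ∩ S₁) ∩ (C \ S₁))
  have b9 := hf.quarter_le_expect_uniformSubset (Finset.inter_subset_right : C ∩ S₁ ⊆ S₁)
  linarith

lemma map_inter_thresholdAdvice (k : ℕ) (Z : ℝ) {f g : Finset Ω → ℝ} {l₁ l₂ : List Ω}
    (hd : l₁.Disjoint l₂) (h : ∀ S ⊆ l₁.toFinset, f S = g S) :
    (thresholdAdvice k Z f (l₁ ++ l₂)).map (fun S => S ∩ l₁.toFinset) =
      thresholdAdvice k Z g l₁ := by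
  rw [thresholdAdvice_eq, thresholdAdvice_eq]
  set τ := Z / (7 * k)
  have e1 : threshold f τ k (l₁ ++ l₂) ∩ l₁.toFinset = threshold g τ k l₁ := by
    rw [threshold_append_inter f τ k hd, threshold_congr h]
  set S := threshold f τ k (l₁ ++ l₂)
  have e2 : threshold f τ k ((l₁ ++ l₂).filter fun x => x ∉ S) ∩ l₁.toFinset =
      threshold g τ k (l₁.filter fun x => x ∉ threshold g τ k l₁) := by
    -- The second run needs `S₁` only to decide whether the arriving element belongs to it, which is
    -- known on arrival; so both runs can proceed simultaneously.
    have e3 : (l₁.filter fun x => x ∉ S) = l₁.filter fun x => x ∉ threshold g τ k l₁ := by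
      refine List.filter_congr fun x hx => ?_
      rw [← e1]
      simp [hx]
    have hsub : (l₁.filter fun x => x ∉ threshold g τ k l₁).toFinset ⊆ l₁.toFinset := by
      intro x; simp +contextual
    have hd' : (l₁.filter fun x => x ∉ threshold g τ k l₁).Disjoint (l₂.filter fun x => x ∉ S) :=
      fun x hx hx' => hd (List.mem_of_mem_filter hx) (List.mem_of_mem_filter hx')
    rw [List.filter_append, e3, ← threshold_congr (fun T hT => h T (hT.trans hsub)),
      ← threshold_append_inter f τ k hd']
    ext x
    have := @threshold_subset _ _ f τ k ((l₁.filter fun x => x ∉ threshold g τ k l₁) ++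
      l₂.filter fun x => x ∉ S) x
    have hx2 : x ∈ l₁ → x ∉ l₂ := fun h h' => hd h h'
    simp only [List.mem_toFinset, List.mem_append, List.mem_filter] at this
    simp only [Finset.mem_inter, List.mem_toFinset, List.mem_filter]
    tauto
  rw [PMF.map_bind]
  congr 1
  funext i
  fin_cases i
  · simp [PMF.pure_map, e1]
  · simp [map_inter_uniformSubset, e1]
  · simpa [PMF.pure_map] using congrArg PMF.pure e2

lemma thresholdAdvice_feasible (k : ℕ) (Z : ℝ) (f : Finset Ω → ℝ) (l : List Ω) :
    ∀ S ∈ (thresholdAdvice k Z f l).support, S ⊆ l.toFinset ∧ S.card ≤ k := by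
  intro S hS
  simp only [thresholdAdvice_eq, PMF.mem_support_bind_iff] at hS
  obtain ⟨i, -, hi⟩ := hS
  have h1 := threshold_subset f (Z / (7 * k)) k l
  have h2 := threshold_card_le f (Z / (7 * k)) k l
  fin_cases i
  · have : S = threshold f (Z / (7 * k)) k l := by simpa using hi
    exact this ▸ ⟨h1, h2⟩
  · have : S ⊆ threshold f (Z / (7 * k)) k l := by simpa [uniformSubset] using hi
    exact ⟨this.trans h1, (Finset.card_le_card this).trans h2⟩
  · have : S = threshold f (Z / (7 * k)) k
        (l.filter fun x => x ∉ threshold f (Z / (7 * k)) k l) := by simpa using hi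
    refine this ▸ ⟨(threshold_subset _ _ _ _).trans ?_, threshold_card_le _ _ _ _⟩
    intro x; simp +contextual

/-- The advice-taking threshold algorithm is an online `21`-approximation. -/
theorem isAdviceApprox_thresholdAdvice [Fintype Ω] {k : ℕ} (hk : 1 ≤ k) :
    IsAdviceApprox (Ω := Ω) k 21 (thresholdAdvice k) where
  feasible Z _ f _ l _ := thresholdAdvice_feasible k Z f l
  online Z _ _ _ _ _ _ _ hl h := map_inter_thresholdAdvice k Z (List.disjoint_of_nodup_append hl) h
  approx _ hf l _ _ hZ hZ' := thresholdAdvice_approx hk hf l hZ hZ'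

end ThresholdAdvice

/-! ### Validity of `submodularSecretaries` in the secretary setting. -/

section Online

lemma pmf_bind_congr {α β : Type*} (p : PMF α) {q q' : α → PMF β}
    (h : ∀ a ∈ p.support, q a = q' a) : p.bind q = p.bind q' := by
  ext b
  rw [PMF.bind_apply, PMF.bind_apply]
  refine tsum_congr fun a => ?_
  by_cases ha : p a = 0
  · simp [ha]
  · rw [h a ((p.mem_support_iff a).2 ha)]

lemma pmf_map_congr {α β : Type*} (p : PMF α) {q q' : α → β}
    (h : ∀ a ∈ p.support, q a = q' a) : p.map q = p.map q' :=
  pmf_bind_congr p fun a ha => congrArg PMF.pure (h a ha)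

variable {Ω : Type*}

/-- The key by which Dynkin's algorithm compares elements. -/
noncomputable def dynkinKey (f : Finset Ω → ℝ) (x : Ω) : ℝ ×ₗ Ω := toLex (f {x}, x)

lemma dynkinKey_injective (f : Finset Ω → ℝ) : Function.Injective (dynkinKey f) := by
  intro x y h
  exact congrArg (fun a => (ofLex a).2) h

variable [LinearOrder Ω]

/-- The length of the observation phase of Dynkin's algorithm on a stream of length `n`. -/
noncomputable def dynkinPhase (n : ℕ) : ℕ := ⌊(n : ℝ) / Real.exp 1⌋₊

lemma mem_dynkin {f : Finset Ω → ℝ} {l : List Ω} {x : Ω} :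
    x ∈ dynkin f l ↔ (l.drop (dynkinPhase l.length)).find?
      (fun x => ∀ y ∈ l.take (dynkinPhase l.length), dynkinKey f y < dynkinKey f x) = some x := by
  unfold dynkin
  change x ∈ (match (l.drop (dynkinPhase l.length)).find?
      (fun x => ∀ y ∈ l.take (dynkinPhase l.length), dynkinKey f y < dynkinKey f x) with
    | some x => {x}
    | none => ∅) ↔ _
  split <;> rename_i h
  · rw [h, Finset.mem_singleton, Option.some_inj, eq_comm]
  · simp [h]

lemma dynkin_subset_drop (f : Finset Ω → ℝ) (l : List Ω) :
    dynkin f l ⊆ (l.drop (dynkinPhase l.length)).toFinset := fun _ hx =>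
  List.mem_toFinset.2 (List.mem_of_find?_eq_some (mem_dynkin.1 hx))

lemma dynkin_card_le (f : Finset Ω → ℝ) (l : List Ω) : (dynkin f l).card ≤ 1 :=
  Finset.card_le_one.2 fun _ hx _ hy =>
    Option.some_inj.1 ((mem_dynkin.1 hx).symm.trans (mem_dynkin.1 hy))

lemma disjoint_drop_append {l₁ l₂ : List Ω} (hl : l₁.Disjoint l₂) {m : ℕ} (hm : l₁.length ≤ m)
    {S : Finset Ω} (hS : S ⊆ ((l₁ ++ l₂).drop m).toFinset) : S ∩ l₁.toFinset = ∅ := by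
  rw [List.drop_append, List.drop_eq_nil_of_le hm, List.nil_append] at hS
  refine Finset.eq_empty_of_forall_notMem fun x hx => ?_
  rw [Finset.mem_inter, List.mem_toFinset] at hx
  exact hl hx.2 (List.mem_of_mem_drop (List.mem_toFinset.1 (hS hx.1)))

/-- Either the prefix lies within the observation phase and nothing of it is selected, or it
contains the whole sample and the search inside it uses prefix data only. -/
lemma dynkin_inter_congr {f g : Finset Ω → ℝ} {l₁ l₂ l₂' : List Ω} (hl : l₁.Disjoint l₂)
    (hl' : l₁.Disjoint l₂') (hlen : l₂.length = l₂'.length)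
    (h : ∀ S ⊆ l₁.toFinset, f S = g S) :
    dynkin f (l₁ ++ l₂) ∩ l₁.toFinset = dynkin g (l₁ ++ l₂') ∩ l₁.toFinset := by
  have hn : (l₁ ++ l₂').length = (l₁ ++ l₂).length := by simp [hlen]
  rcases le_total l₁.length (dynkinPhase (l₁ ++ l₂).length) with hr | hr
  · rw [disjoint_drop_append hl hr (dynkin_subset_drop _ _),
      disjoint_drop_append hl' (hn ▸ hr) (dynkin_subset_drop _ _)]
  set r := dynkinPhase (l₁ ++ l₂).length with hrdef
  have key (f : Finset Ω → ℝ) (l : List Ω) (hl : l₁.Disjoint l)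
      (hn : dynkinPhase (l₁ ++ l).length = r) (x : Ω) (hx : x ∈ l₁) :
      x ∈ dynkin f (l₁ ++ l) ↔ (l₁.drop r).find?
        (fun x => ∀ y ∈ l₁.take r, dynkinKey f y < dynkinKey f x) = some x := by
    rw [mem_dynkin, hn, List.take_append_of_le_length hr, List.drop_append_of_le_length hr,
      List.find?_append, Option.or_eq_some_iff]
    refine ⟨fun h => h.resolve_right fun h' => hl hx (List.mem_of_find?_eq_some h'.2), Or.inl⟩
  ext x
  simp only [Finset.mem_inter, List.mem_toFinset]
  refine and_congr_left fun hx => ?_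
  rw [key f l₂ hl rfl x hx, key g l₂' hl' (by rw [hn]) x hx]
  have hk : ∀ y ∈ l₁, dynkinKey f y = dynkinKey g y := fun y hy => by
    rw [dynkinKey, dynkinKey, h {y} (by simpa using hy)]
  suffices ∀ t : List Ω, (∀ y ∈ t, y ∈ l₁) →
      t.find? (fun x => ∀ y ∈ l₁.take r, dynkinKey f y < dynkinKey f x) =
      t.find? (fun x => ∀ y ∈ l₁.take r, dynkinKey g y < dynkinKey g x) by
    rw [this _ fun y => List.mem_of_mem_drop]
  intro t ht
  induction t with
  | nil => rfl
  | cons a t ih =>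
    have ha : (∀ y ∈ l₁.take r, dynkinKey f y < dynkinKey f a) ↔
        ∀ y ∈ l₁.take r, dynkinKey g y < dynkinKey g a :=
      forall₂_congr fun y hy => by
        rw [hk y (List.mem_of_mem_take hy), hk a (ht a List.mem_cons_self)]
    rw [List.find?_cons, List.find?_cons, ih fun y hy => ht y (List.mem_cons_of_mem _ hy),
      decide_eq_decide.2 ha]

variable (Off : (Finset Ω → ℝ) → Finset Ω → PMF (Finset Ω))
  (On : ℝ → (Finset Ω → ℝ) → List Ω → PMF (Finset Ω))

/-- Run the offline algorithm on the first `m` elements of the stream, and the online algorithm on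
the remaining elements with the value obtained as advice. -/
noncomputable def splitRun (f : Finset Ω → ℝ) (l : List Ω) (m : ℕ) : PMF (Finset Ω) :=
  (Off f (l.take m).toFinset).bind fun A₁ => On (f A₁) f (l.drop m)

set_option linter.deprecated false in
/-- The branch of `submodularSecretaries` that splits the stream. -/
noncomputable def tails (f : Finset Ω → ℝ) (l : List Ω) : PMF (Finset Ω) :=
  (PMF.binomial (1 / 2) (by norm_num) l.length).bind fun m => splitRun Off On f l m

lemma submodularSecretaries_eq (f : Finset Ω → ℝ) (l : List Ω) :
    submodularSecretaries Off On f l = (PMF.uniformOfFintype Bool).bind fun heads =>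
      if heads then PMF.pure (dynkin f l) else tails Off On f l :=
  rfl

variable {Off On} [Fintype Ω] {k : ℕ} {ρoff ρon : ℝ}

lemma splitRun_subset_drop (hOn : IsAdviceApprox k ρon On) {f : Finset Ω → ℝ}
    (hf : IsValuation f) {l : List Ω} (hl : l.Nodup) (m : ℕ) :
    ∀ S ∈ (splitRun Off On f l m).support, S ⊆ (l.drop m).toFinset ∧ S.card ≤ k := by
  intro S hS
  obtain ⟨A, -, hA⟩ := (PMF.mem_support_bind_iff _ _ _).1 hS
  exact hOn.feasible _ (hf.nonneg A) f hf _ (hl.sublist (List.drop_sublist m l)) S hA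

lemma map_inter_splitRun_of_le (hOff : IsOfflineApprox k ρoff Off)
    (hOn : IsAdviceApprox k ρon On) {f g : Finset Ω → ℝ} (hf : IsValuation f)
    (hg : IsValuation g) {l₁ l₂ : List Ω} (hl : (l₁ ++ l₂).Nodup)
    (h : ∀ S ⊆ l₁.toFinset, f S = g S) {m : ℕ} (hm : m ≤ l₁.length) :
    (splitRun Off On f (l₁ ++ l₂) m).map (fun S => S ∩ l₁.toFinset) =
      splitRun Off On g l₁ m := by
  have htake : (l₁.take m).toFinset ⊆ l₁.toFinset := fun x hx =>
    List.mem_toFinset.2 (List.mem_of_mem_take (List.mem_toFinset.1 hx))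
  have hdrop : (l₁.drop m).toFinset ⊆ l₁.toFinset := fun x hx =>
    List.mem_toFinset.2 (List.mem_of_mem_drop (List.mem_toFinset.1 hx))
  have hl' : (l₁.drop m ++ l₂).Nodup := hl.sublist ((List.drop_sublist m l₁).append_right l₂)
  unfold splitRun
  rw [List.take_append_of_le_length hm, List.drop_append_of_le_length hm, PMF.map_bind,
    hOff.oracle f g hf hg _ fun S hS => h S (hS.trans htake)]
  refine pmf_bind_congr _ fun A hA => ?_
  have hA' := (hOff.feasible g hg _ A hA).1.trans htake
  rw [← h A hA', ← hOn.online (f A) (hf.nonneg A) f g hf hg _ _ hl' fun S hS =>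
    h S (hS.trans hdrop)]
  refine pmf_map_congr _ fun S hS => ?_
  have hS' := (hOn.feasible (f A) (hf.nonneg A) f hf _ hl' S hS).1
  ext x
  have h1 := @hS' x
  have h2 : x ∈ l₁ → x ∉ l₂ := fun h h' => List.disjoint_of_nodup_append hl h h'
  have h3 := @hdrop x
  simp only [List.toFinset_append, Finset.mem_union, List.mem_toFinset] at h1 h3
  simp only [Finset.mem_inter, List.mem_toFinset]
  tauto

lemma map_inter_splitRun_of_ge (hOn : IsAdviceApprox k ρon On) {f : Finset Ω → ℝ}
    (hf : IsValuation f) {l₁ l₂ : List Ω} (hl : (l₁ ++ l₂).Nodup) {m : ℕ} (hm : l₁.length ≤ m) :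
    (splitRun Off On f (l₁ ++ l₂) m).map (fun S => S ∩ l₁.toFinset) = PMF.pure ∅ := by
  rw [pmf_map_congr (q' := fun _ => ∅) _ fun S hS => disjoint_drop_append
    (List.disjoint_of_nodup_append hl) hm (splitRun_subset_drop hOn hf hl m S hS).1]
  exact PMF.map_const _ _

/-- `submodularSecretaries` is a valid algorithm for the secretary setting. -/
theorem isSecretaryAlgorithm_submodularSecretaries (hk : 1 ≤ k)
    (hOff : IsOfflineApprox k ρoff Off) (hOn : IsAdviceApprox k ρon On) :
    IsSecretaryAlgorithm k (submodularSecretaries Off On) where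
  feasible f hf l hl S hS := by
    rw [submodularSecretaries_eq, PMF.mem_support_bind_iff] at hS
    obtain ⟨b, -, hb⟩ := hS
    have hdrop (m : ℕ) : (l.drop m).toFinset ⊆ l.toFinset := fun x hx =>
      List.mem_toFinset.2 (List.mem_of_mem_drop (List.mem_toFinset.1 hx))
    cases b with
    | true =>
      have : S = dynkin f l := by simpa using hb
      exact this ▸ ⟨(dynkin_subset_drop f l).trans (hdrop _), (dynkin_card_le f l).trans hk⟩
    | false =>
      simp only [Bool.false_eq_true, if_false, tails, PMF.mem_support_bind_iff] at hb
      obtain ⟨m, -, hm⟩ := hb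
      have := splitRun_subset_drop hOn hf hl m S hm
      exact ⟨this.1.trans (hdrop _), this.2⟩
  online f g hf hg l₁ l₂ l₂' hl hl' hlen h := by
    have hn : (l₁ ++ l₂').length = (l₁ ++ l₂).length := by simp [hlen]
    rw [submodularSecretaries_eq, submodularSecretaries_eq, PMF.map_bind, PMF.map_bind]
    congr 1
    funext b
    cases b with
    | true =>
      simp only [if_true, PMF.pure_map]
      rw [dynkin_inter_congr (List.disjoint_of_nodup_append hl)
        (List.disjoint_of_nodup_append hl') hlen h]
    | false =>
      simp only [Bool.false_eq_true, if_false, tails]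
      rw [PMF.map_bind, PMF.map_bind, hn]
      congr 1
      funext m
      -- A split point inside the prefix leaves a run determined by the prefix; a later one puts the
      -- whole prefix in the sample, from which nothing is selected.
      rcases le_total (m : ℕ) l₁.length with hm | hm
      · rw [map_inter_splitRun_of_le hOff hOn hf hg hl h hm,
          map_inter_splitRun_of_le hOff hOn hg hg hl' (fun _ _ => rfl) hm]
      · rw [map_inter_splitRun_of_ge hOn hf hl hm,
          map_inter_splitRun_of_ge hOn hg hl' hm]

end Online

/-! ### Expected values as averages over enumerations. -/

section Value

variable {Ω : Type*} [Fintype Ω]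

/-- The definition elaborates with permutations coerced to functions inside the monad; this form
keeps the permutations themselves. -/
lemma randomOrder_eq [DecidableEq Ω] : randomOrder Ω =
    (PMF.uniformOfFintype (Equiv.Perm Ω)).map fun π : Equiv.Perm Ω =>
      (Finset.univ : Finset Ω).toList.map (π : Ω → Ω) := by
  change PMF.map (fun π : Ω → Ω => (Finset.univ : Finset Ω).toList.map π)
    ((PMF.uniformOfFintype (Equiv.Perm Ω)).bind fun π : Equiv.Perm Ω =>
      PMF.pure (π : Ω → Ω)) = _
  rw [PMF.map_bind]
  simp only [PMF.pure_map]
  rfl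

/-- Averaging over a random order means averaging over all enumerations of the universe. -/
lemma secretaryValue_eq [DecidableEq Ω] (A : (Finset Ω → ℝ) → List Ω → PMF (Finset Ω))
    (f : Finset Ω → ℝ) :
    secretaryValue A f = ((Fintype.card Ω).factorial : ℝ)⁻¹ *
      ∑ σ : Fin (Fintype.card Ω) ≃ Ω, expect (A f (List.ofFn σ)) f := by
  have hlen : (Finset.univ : Finset Ω).toList.length = Fintype.card Ω := by simp
  obtain ⟨e, he⟩ : ∃ e : Fin (Fintype.card Ω) ≃ Ω,
      (Finset.univ : Finset Ω).toList = List.ofFn e := by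
    refine ⟨(finCongr hlen.symm).trans (List.Nodup.getEquivOfForallMemList _
      (Finset.nodup_toList _) fun x => by simp), ?_⟩
    refine List.ext_getElem (by simp) fun i h1 h2 => ?_
    simp
  rw [secretaryValue, randomOrder_eq, PMF.bind_map, expect_bind, Finset.mul_sum]
  refine Fintype.sum_equiv (Equiv.equivCongr e.symm (Equiv.refl Ω)) _
    (fun σ => ((Fintype.card Ω).factorial : ℝ)⁻¹ * expect (A f (List.ofFn σ)) f) fun π => ?_
  have h2 : (Finset.univ : Finset Ω).toList.map π =
      List.ofFn (Equiv.equivCongr e.symm (Equiv.refl Ω) π) := by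
    rw [he, List.map_ofFn]
    rfl
  rw [Function.comp_apply, h2, PMF.uniformOfFintype_apply, Fintype.card_perm]
  simp

variable [LinearOrder Ω] (Off : (Finset Ω → ℝ) → Finset Ω → PMF (Finset Ω))
  (On : ℝ → (Finset Ω → ℝ) → List Ω → PMF (Finset Ω))

lemma expect_submodularSecretaries (f : Finset Ω → ℝ) (l : List Ω) :
    expect (submodularSecretaries Off On f l) f =
      f (dynkin f l) / 2 + expect (tails Off On f l) f / 2 := by
  rw [submodularSecretaries_eq, expect_bind, Fintype.sum_bool]
  simp [expect_pure]
  ring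

set_option linter.deprecated false in
lemma expect_tails (f : Finset Ω → ℝ) (l : List Ω) :
    expect (tails Off On f l) f = ((2 : ℝ) ^ l.length)⁻¹ *
      ∑ m ∈ Finset.range (l.length + 1),
        (l.length.choose m : ℝ) * expect (splitRun Off On f l m) f := by
  rw [tails, expect_bind, Finset.mul_sum, ← Fin.sum_univ_eq_sum_range
    (fun m => ((2 : ℝ) ^ l.length)⁻¹ * ((l.length.choose m : ℝ) *
      expect (splitRun Off On f l m) f))]
  refine Finset.sum_congr rfl fun m _ => ?_
  have hm : (m : ℕ) ≤ l.length := Nat.lt_succ_iff.1 m.2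
  have h : (PMF.binomial (1 / 2) (by norm_num) l.length m).toReal =
      ((2 : ℝ) ^ l.length)⁻¹ * l.length.choose m := by
    have h2 : (1 - ((1 / 2 : NNReal) : ENNReal)).toReal = 1 / 2 := by
      rw [ENNReal.toReal_sub_of_le (by norm_num) (by simp)]
      norm_num
    rw [PMF.binomial_apply, ENNReal.toReal_mul, ENNReal.toReal_mul, ENNReal.toReal_pow,
      ENNReal.toReal_pow, h2, ENNReal.toReal_natCast, ENNReal.coe_toReal, NNReal.coe_div,
      NNReal.coe_one, NNReal.coe_ofNat, ← pow_add, Fin.val_last, Nat.add_sub_cancel' hm]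
    simp
  rw [h, mul_assoc]

end Value

/-! ### The binomial prefix is a uniform subset; second moments of random signs. -/

section RandomSplit

variable {ι Ω : Type*} [Fintype ι] [DecidableEq ι] [Fintype Ω] [DecidableEq Ω]

/-- Precomposition with a permutation of the indices carrying `P` to `Q`. -/
lemma sum_equiv_map_eq_of_card_eq (ψ : Finset Ω → ℝ) {P Q : Finset ι} (h : P.card = Q.card) :
    ∑ σ : ι ≃ Ω, ψ (P.map σ.toEmbedding) = ∑ σ : ι ≃ Ω, ψ (Q.map σ.toEmbedding) := by
  set τ : Equiv.Perm ι := (Finset.equivOfCardEq h).extendSubtype with hτ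
  have hmap : P.map τ.toEmbedding = Q := by
    refine Finset.eq_of_subset_of_card_le (fun x hx => ?_) (by simp [h])
    obtain ⟨y, hy, rfl⟩ := Finset.mem_map.1 hx
    exact (Finset.equivOfCardEq h).extendSubtype_mem y hy
  refine Fintype.sum_equiv (Equiv.equivCongr τ (Equiv.refl Ω)) _ _ fun σ => ?_
  rw [← hmap, Finset.map_map]
  congr 2
  ext x
  simp [Equiv.equivCongr]

/-- Double counting of pairs of an enumeration and an index set `Q` of the size of `P`: the sum
depends on `Q` only through its size, and each enumeration maps the index sets bijectively to
subsets of `Ω`. -/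
lemma choose_mul_sum_equiv_map (ψ : Finset Ω → ℝ) (P : Finset ι) :
    ((Fintype.card ι).choose P.card : ℝ) * ∑ σ : ι ≃ Ω, ψ (P.map σ.toEmbedding) =
      Fintype.card (ι ≃ Ω) * ∑ X ∈ Finset.univ.powersetCard P.card, ψ X := by
  have h1 : ∑ Q ∈ (Finset.univ : Finset ι).powersetCard P.card,
      ∑ σ : ι ≃ Ω, ψ (Q.map σ.toEmbedding) =
      ((Fintype.card ι).choose P.card : ℝ) * ∑ σ : ι ≃ Ω, ψ (P.map σ.toEmbedding) := by
    rw [Finset.sum_congr rfl fun Q hQ =>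
      sum_equiv_map_eq_of_card_eq ψ (Finset.mem_powersetCard.1 hQ).2, Finset.sum_const,
      Finset.card_powersetCard, nsmul_eq_mul, Finset.card_univ]
  rw [← h1, Finset.sum_comm]
  have h2 (σ : ι ≃ Ω) : ∑ Q ∈ (Finset.univ : Finset ι).powersetCard P.card,
      ψ (Q.map σ.toEmbedding) = ∑ X ∈ Finset.univ.powersetCard P.card, ψ X := by
    have : (Finset.univ : Finset Ω) = Finset.univ.map σ.toEmbedding := by simp
    rw [this, Finset.powersetCard_map, Finset.sum_map]
    rfl
  simp only [h2, Finset.sum_const, nsmul_eq_mul, Finset.card_univ]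

/-- The first `Bin(n, 1/2)` elements of a random enumeration form a uniformly random subset. -/
lemma sum_ofFn_take (ψ : Finset Ω → ℝ) :
    ∑ σ : Fin (Fintype.card Ω) ≃ Ω, ∑ m ∈ Finset.range (Fintype.card Ω + 1),
        ((Fintype.card Ω).choose m : ℝ) * ψ ((List.ofFn σ).take m).toFinset =
      (Fintype.card Ω).factorial * ∑ X, ψ X := by
  have hcard : Fintype.card (Fin (Fintype.card Ω) ≃ Ω) = (Fintype.card Ω).factorial := by
    rw [Fintype.card_equiv (Fintype.equivFin Ω).symm, Fintype.card_fin]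
  rw [Finset.sum_comm, ← Finset.powerset_univ, Finset.sum_powerset, Finset.card_univ,
    Finset.mul_sum]
  refine Finset.sum_congr rfl fun m hm => ?_
  have hm' : m ≤ Fintype.card Ω := Nat.lt_succ_iff.1 (Finset.mem_range.1 hm)
  set P : Finset (Fin (Fintype.card Ω)) := Finset.univ.filter fun i => (i : ℕ) < m with hP
  have hPc : P.card = m := by
    rw [hP, Fin.card_filter_val_lt, min_eq_right hm']
  have h := choose_mul_sum_equiv_map ψ P
  rw [hPc, hcard, Fintype.card_fin] at h
  rw [← h, Finset.mul_sum]
  refine Finset.sum_congr rfl fun σ _ => ?_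
  congr 2
  ext x
  simp only [List.mem_toFinset, List.mem_take_iff_getElem, List.getElem_ofFn, List.length_ofFn,
    Finset.mem_map, hP, Finset.mem_filter, Finset.mem_univ, true_and, Equiv.coe_toEmbedding]
  constructor
  · rintro ⟨i, hi, rfl⟩
    exact ⟨⟨i, (lt_min_iff.1 hi).2⟩, (lt_min_iff.1 hi).1, rfl⟩
  · rintro ⟨i, hi, rfl⟩
    exact ⟨i, lt_min hi i.2, rfl⟩

/-- The sign of the membership of `i` in `X`. -/
def memSign (X : Finset Ω) (i : Ω) : ℝ := if i ∈ X then 1 else -1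

lemma sum_memSign_mul_memSign {i j : Ω} (hij : i ≠ j) :
    ∑ X : Finset Ω, memSign X i * memSign X j = 0 := by
  -- Toggling the membership of `i` flips exactly one of the two signs.
  refine Finset.sum_involution (fun X _ => symmDiff X {i}) (fun X _ => ?_) (fun X _ _ => ?_)
    (fun _ _ => Finset.mem_univ _) (fun X _ => by simp)
  · have h1 : memSign (symmDiff X {i}) i = - memSign X i := by
      unfold memSign
      by_cases h : i ∈ X <;> simp [Finset.mem_symmDiff, h]
    have h2 : memSign (symmDiff X {i}) j = memSign X j := by
      unfold memSign
      simp [Finset.mem_symmDiff, hij.symm]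
    rw [h1, h2]
    ring
  · simp

lemma sum_sq_memSign (C : Finset Ω) (w : Ω → ℝ) :
    ∑ X : Finset Ω, (∑ i ∈ C, w i * memSign X i) ^ 2 =
      2 ^ Fintype.card Ω * ∑ i ∈ C, w i ^ 2 := by
  have h1 (X : Finset Ω) : (∑ i ∈ C, w i * memSign X i) ^ 2 =
      ∑ i ∈ C, ∑ j ∈ C, w i * w j * (memSign X i * memSign X j) := by
    rw [sq, Finset.sum_mul_sum]
    refine Finset.sum_congr rfl fun i _ => Finset.sum_congr rfl fun j _ => by ring
  simp only [h1]
  rw [Finset.sum_comm, Finset.mul_sum]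
  refine Finset.sum_congr rfl fun i hi => ?_
  rw [Finset.sum_comm, Finset.sum_eq_single i]
  · rw [← Finset.mul_sum]
    have : ∀ X : Finset Ω, memSign X i * memSign X i = 1 := fun X => by
      unfold memSign; split_ifs <;> norm_num
    simp only [this, Finset.sum_const, nsmul_eq_mul, Finset.card_univ, Fintype.card_finset]
    push_cast
    ring
  · intro j _ hj
    rw [← Finset.mul_sum, sum_memSign_mul_memSign hj.symm, mul_zero]
  · exact fun h => absurd hi h

end RandomSplit

/-! ### The optimum of a random half. -/

section Halves

variable {Ω : Type*} [DecidableEq Ω] {f : Finset Ω → ℝ}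

/-- A submodular function dominates, below `S`, an additive function with the same value at `S`
whose weights lie between the last and the first marginal values. -/
lemma IsValuation.exists_weights (hf : IsValuation f) (S : Finset Ω) :
    ∃ w : Ω → ℝ, (∀ i ∈ S, f S - f (S.erase i) ≤ w i ∧ w i ≤ f {i}) ∧
      ∑ i ∈ S, w i = f S ∧ ∀ T ⊆ S, ∑ i ∈ T, w i ≤ f T := by
  induction S using Finset.induction_on with
  | empty =>
    refine ⟨0, by simp, by simp [hf.empty], fun T hT => ?_⟩
    rw [Finset.subset_empty.1 hT]
    simp [hf.empty]
  | insert a S ha ih =>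
    obtain ⟨w, hw, hsum, hle⟩ := ih
    have hne : ∀ i ∈ S, i ≠ a := fun i hi h => ha (h ▸ hi)
    have hupd : ∀ T ⊆ S, ∑ i ∈ T, Function.update w a (f (insert a S) - f S) i =
        ∑ i ∈ T, w i := fun T hT =>
      Finset.sum_congr rfl fun i hi => Function.update_of_ne (hne i (hT hi)) _ _
    -- The weights are the marginal values along the insertion order, so they telescope to the value
    -- of the set.
    refine ⟨Function.update w a (f (insert a S) - f S), ?_, ?_, ?_⟩
    · intro i hi
      rcases Finset.mem_insert.1 hi with rfl | hi
      · rw [Function.update_self, Finset.erase_insert ha]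
        refine ⟨le_rfl, ?_⟩
        simpa [hf.empty] using hf.marginal_le (Finset.empty_subset S) ha
      · rw [Function.update_of_ne (hne i hi)]
        refine ⟨le_trans ?_ (hw i hi).1, (hw i hi).2⟩
        have h := hf.marginal_le (Finset.erase_subset_erase i (Finset.subset_insert a S))
          (Finset.notMem_erase i (insert a S))
        rwa [Finset.insert_erase (Finset.mem_insert_of_mem hi), Finset.insert_erase hi] at h
    · rw [Finset.sum_insert ha, hupd S subset_rfl, hsum, Function.update_self]
      ring
    · intro T hT
      by_cases haT : a ∈ T
      · have hT' : T.erase a ⊆ S := Finset.subset_insert_iff.1 hT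
        have h := hf.marginal_le hT' ha
        rw [Finset.insert_erase haT] at h
        rw [← Finset.add_sum_erase T _ haT, hupd _ hT', Function.update_self]
        linarith [hle _ hT']
      · have hT' : T ⊆ S := (Finset.subset_insert_iff_of_notMem haT).1 hT
        rw [hupd T hT']
        exact hle T hT'

variable [Fintype Ω]

/-- If no single element has value above `OPT / c`, then both parts of a uniformly random
bipartition have, in expectation, optimum at least `(1 - 1 / √c) * OPT / 2`. -/
lemma IsValuation.sum_min_opt_ge (hf : IsValuation f) (k : ℕ) {c : ℝ} (hc : 0 < c)
    (hsmall : ∀ x, f {x} ≤ opt f k Finset.univ / c) :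
    2 ^ Fintype.card Ω * ((1 - 1 / √c) * opt f k Finset.univ / 2) ≤
      ∑ X : Finset Ω, min (opt f k X) (opt f k Xᶜ) := by
  obtain ⟨C, -, hCk, hC⟩ := exists_opt f k Finset.univ
  have hO := hf.opt_nonneg k Finset.univ
  set O := opt f k Finset.univ
  obtain ⟨w, hw, hsum, hle⟩ := hf.exists_weights C
  rw [hC] at hsum
  -- Optimality of `C` replaces monotonicity: removing an element leaves a feasible set, so no last
  -- marginal value is negative.
  have hw0 : ∀ i ∈ C, 0 ≤ w i := fun i hi => by
    have : f (C.erase i) ≤ O :=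
      le_opt f (Finset.subset_univ _) ((Finset.card_le_card (Finset.erase_subset i C)).trans hCk)
    linarith [(hw i hi).1]
  have hmin (X : Finset Ω) :
      O / 2 - |∑ i ∈ C, w i * memSign X i| / 2 ≤ min (opt f k X) (opt f k Xᶜ) := by
    have hsplit : ∑ i ∈ C ∩ X, w i + ∑ i ∈ C \ X, w i = O := by
      rw [← hsum, Finset.sum_inter_add_sum_sdiff]
    have hdiff : ∑ i ∈ C, w i * memSign X i = ∑ i ∈ C ∩ X, w i - ∑ i ∈ C \ X, w i := by
      rw [← Finset.sum_inter_add_sum_sdiff C X, sub_eq_add_neg, ← Finset.sum_neg_distrib]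
      congr 1
      · refine Finset.sum_congr rfl fun i hi => ?_
        simp [memSign, (Finset.mem_inter.1 hi).2]
      · refine Finset.sum_congr rfl fun i hi => ?_
        simp [memSign, (Finset.mem_sdiff.1 hi).2]
    have h1 : ∑ i ∈ C ∩ X, w i ≤ opt f k X :=
      (hle _ Finset.inter_subset_left).trans (le_opt f Finset.inter_subset_right
        ((Finset.card_le_card Finset.inter_subset_left).trans hCk))
    have h2 : ∑ i ∈ C \ X, w i ≤ opt f k Xᶜ :=
      (hle _ Finset.sdiff_subset).trans (le_opt f (fun x => by simp +contextual)
        ((Finset.card_le_card Finset.sdiff_subset).trans hCk))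
    rw [hdiff]
    have h3 := le_abs_self (∑ i ∈ C ∩ X, w i - ∑ i ∈ C \ X, w i)
    have h4 := neg_abs_le (∑ i ∈ C ∩ X, w i - ∑ i ∈ C \ X, w i)
    exact le_min (by linarith) (by linarith)
  have hsq : ∑ i ∈ C, w i ^ 2 ≤ O ^ 2 / c := by
    calc ∑ i ∈ C, w i ^ 2 ≤ ∑ i ∈ C, w i * (O / c) := by
          refine Finset.sum_le_sum fun i hi => ?_
          rw [sq]
          exact mul_le_mul_of_nonneg_left ((hw i hi).2.trans (hsmall i)) (hw0 i hi)
      _ = O ^ 2 / c := by rw [← Finset.sum_mul, hsum]; ring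
  -- First absolute moment against second moment, by Cauchy–Schwarz over all subsets.
  have habs : ∑ X : Finset Ω, |∑ i ∈ C, w i * memSign X i| ≤ 2 ^ Fintype.card Ω * (O / √c) := by
    refine abs_le_of_sq_le_sq' ?_ (by positivity) |>.2
    have h := sq_sum_le_card_mul_sum_sq (s := (Finset.univ : Finset (Finset Ω)))
      (f := fun X => |∑ i ∈ C, w i * memSign X i|)
    simp only [sq_abs, Finset.card_univ, Fintype.card_finset] at h
    rw [sum_sq_memSign] at h
    refine h.trans ?_
    rw [mul_pow, div_pow, Real.sq_sqrt hc.le, sq, mul_assoc]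
    push_cast
    gcongr
  have hfin := Finset.sum_le_sum fun X (_ : X ∈ Finset.univ) => hmin X
  rw [Finset.sum_sub_distrib, Finset.sum_const, nsmul_eq_mul, Finset.card_univ,
    Fintype.card_finset, ← Finset.sum_div] at hfin
  refine le_trans ?_ hfin
  push_cast
  have : (2 : ℝ) ^ Fintype.card Ω * ((1 - 1 / √c) * O / 2) =
    2 ^ Fintype.card Ω * (O / 2) - 2 ^ Fintype.card Ω * (O / √c) / 2 := by ring
  rw [this]
  linarith

/-- Complementation pairs the sets whose value is the smaller one with those whose complement has
it; ties are counted on both sides, which only helps. -/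
lemma sum_ite_le_compl_ge {a : Finset Ω → ℝ} (ha : ∀ X, 0 ≤ a X) :
    (∑ X : Finset Ω, min (a X) (a Xᶜ)) / 2 ≤
      ∑ X : Finset Ω, if a X ≤ a Xᶜ then a X else 0 := by
  have h1 : ∑ X : Finset Ω, (if a X ≤ a Xᶜ then a X else 0) =
      ∑ X : Finset Ω, (if a Xᶜ ≤ a X then a Xᶜ else 0) := by
    refine Fintype.sum_bijective compl compl_bijective _ _ fun X => ?_
    rw [compl_compl]
  have h2 : ∑ X : Finset Ω, min (a X) (a Xᶜ) ≤
      ∑ X : Finset Ω, ((if a X ≤ a Xᶜ then a X else 0) + (if a Xᶜ ≤ a X then a Xᶜ else 0)) := by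
    refine Finset.sum_le_sum fun X _ => ?_
    have := ha X
    have := ha Xᶜ
    rcases lt_or_ge (a Xᶜ) (a X) with h | h
    · rw [if_neg h.not_ge, if_pos h.le, min_eq_right h.le, zero_add]
    · rw [if_pos h, min_eq_left h]
      split_ifs <;> linarith
  rw [Finset.sum_add_distrib, ← h1] at h2
  linarith

end Halves

/-! ### The value of the splitting branch. -/

section Tails

variable {Ω : Type*} [Fintype Ω] [LinearOrder Ω] {k : ℕ} {ρoff ρon : ℝ}
  {Off : (Finset Ω → ℝ) → Finset Ω → PMF (Finset Ω)}
  {On : ℝ → (Finset Ω → ℝ) → List Ω → PMF (Finset Ω)} {f : Finset Ω → ℝ}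

lemma le_expect_splitRun (hρon : 1 ≤ ρon) (hOff : IsOfflineApprox k ρoff Off)
    (hOn : IsAdviceApprox k ρon On) (hf : IsValuation f) {l : List Ω} (hl : l.Nodup) (m : ℕ)
    (h : opt f k (l.take m).toFinset ≤ opt f k (l.drop m).toFinset) :
    opt f k (l.take m).toFinset / (ρoff * ρon) ≤ expect (splitRun Off On f l m) f := by
  rw [splitRun, expect_bind]
  have h1 := hOff.approx f hf (l.take m).toFinset
  calc opt f k (l.take m).toFinset / (ρoff * ρon)
      ≤ expect (Off f (l.take m).toFinset) f / ρon := by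
        rw [← div_div]
        exact div_le_div_of_nonneg_right h1 (by linarith)
    _ = ∑ A, (Off f (l.take m).toFinset A).toReal * (f A / ρon) := by
        rw [expect, Finset.sum_div]
        exact Finset.sum_congr rfl fun A _ => mul_div_assoc _ _ _
    _ ≤ _ := by
        refine Finset.sum_le_sum fun A _ => ?_
        by_cases hA : Off f (l.take m).toFinset A = 0
        · simp [hA]
        have hA' := hOff.feasible f hf _ A ((PMF.mem_support_iff _ _).2 hA)
        exact mul_le_mul_of_nonneg_left (hOn.approx f hf _ (hl.sublist (List.drop_sublist m l)) _
          (hf.nonneg A) ((le_opt f hA'.1 hA'.2).trans h)) ENNReal.toReal_nonneg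

lemma toFinset_drop_ofFn {n : ℕ} (σ : Fin n ≃ Ω) (m : ℕ) :
    ((List.ofFn σ).drop m).toFinset = (((List.ofFn σ).take m).toFinset)ᶜ := by
  have hnd : (List.ofFn σ).Nodup := List.nodup_ofFn.2 σ.injective
  have hd : ((List.ofFn σ).take m).Disjoint ((List.ofFn σ).drop m) :=
    List.disjoint_of_nodup_append (by rwa [List.take_append_drop])
  ext x
  have hx : x ∈ (List.ofFn σ).take m ++ (List.ofFn σ).drop m := by
    rw [List.take_append_drop]
    exact List.mem_ofFn.2 (σ.surjective x)
  rw [List.mem_append] at hx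
  simp only [List.mem_toFinset, Finset.mem_compl]
  exact ⟨fun h h' => hd h' h, fun h => hx.resolve_left h⟩

lemma le_sum_expect_tails (hρoff : 1 ≤ ρoff) (hρon : 1 ≤ ρon) (hOff : IsOfflineApprox k ρoff Off)
    (hOn : IsAdviceApprox k ρon On) (hf : IsValuation f) {c : ℝ} (hc : 0 < c)
    (hsmall : ∀ x, f {x} ≤ opt f k Finset.univ / c) :
    (1 - 1 / √c) * opt f k Finset.univ / (4 * ρoff * ρon) ≤
      ((Fintype.card Ω).factorial : ℝ)⁻¹ *
        ∑ σ : Fin (Fintype.card Ω) ≃ Ω, expect (tails Off On f (List.ofFn σ)) f := by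
  set ψ : Finset Ω → ℝ := fun X => (if opt f k X ≤ opt f k Xᶜ then opt f k X else 0) with hψ
  have h1 (σ : Fin (Fintype.card Ω) ≃ Ω) :
      ((2 : ℝ) ^ Fintype.card Ω)⁻¹ * ((ρoff * ρon)⁻¹ *
        ∑ m ∈ Finset.range (Fintype.card Ω + 1), ((Fintype.card Ω).choose m : ℝ) *
          ψ ((List.ofFn σ).take m).toFinset) ≤ expect (tails Off On f (List.ofFn σ)) f := by
    rw [expect_tails, List.length_ofFn, Finset.mul_sum]
    refine mul_le_mul_of_nonneg_left (Finset.sum_le_sum fun m _ => ?_) (by positivity)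
    rw [mul_left_comm]
    refine mul_le_mul_of_nonneg_left ?_ (by positivity)
    simp only [hψ]
    split_ifs with h
    · rw [← toFinset_drop_ofFn] at h
      rw [inv_mul_eq_div]
      exact le_expect_splitRun hρon hOff hOn hf (List.nodup_ofFn.2 σ.injective) m h
    · rw [mul_zero]
      exact expect_nonneg _ hf.nonneg
  have h2 := Finset.sum_le_sum fun σ (_ : σ ∈ Finset.univ) => h1 σ
  rw [← Finset.mul_sum, ← Finset.mul_sum, sum_ofFn_take] at h2
  have h3 := (div_le_div_of_nonneg_right (hf.sum_min_opt_ge k hc hsmall) zero_le_two).trans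
    (sum_ite_le_compl_ge (hf.opt_nonneg k))
  have hfac : (0 : ℝ) < (Fintype.card Ω).factorial := by exact_mod_cast Nat.factorial_pos _
  rw [inv_mul_eq_div, le_div_iff₀ hfac]
  refine le_trans ?_ h2
  have hρ : 0 < ρoff * ρon := by positivity
  calc (1 - 1 / √c) * opt f k Finset.univ / (4 * ρoff * ρon) * (Fintype.card Ω).factorial
      = ((2 : ℝ) ^ Fintype.card Ω)⁻¹ * ((ρoff * ρon)⁻¹ * ((Fintype.card Ω).factorial *
        (2 ^ Fintype.card Ω * ((1 - 1 / √c) * opt f k Finset.univ / 2) / 2))) := by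
        field_simp
        ring
    _ ≤ _ := by gcongr

end Tails

/-! ### The numerical bound 1/e for Dynkin's rule with a floored observation phase. -/

lemma log_succ_div_le {i : ℕ} (hi : 0 < i) :
    Real.log ((i + 1 : ℝ) / i) ≤ (1 / i + 1 / (i + 1)) / 2 := by
  have hi' : (0 : ℝ) < i := by exact_mod_cast hi
  have hx : (1 : ℝ) ≤ (i + 1 : ℝ) / i := by rw [le_div_iff₀ hi']; linarith
  -- `t ≤ sinh t` at `t = log x` reads `log x ≤ (x - 1/x) / 2`, the trapezoidal estimate.
  have h := Real.self_le_sinh_iff.2 (Real.log_nonneg hx)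
  rw [Real.sinh_log (by linarith)] at h
  refine h.trans (le_of_eq ?_)
  field_simp
  ring

/-- The trapezoidal correction is kept because it pays for rounding `n / e` down. -/
lemma log_div_add_le_sum_Ico {r n : ℕ} (hr : 0 < r) (hrn : r ≤ n) :
    Real.log (n / r) + (1 / r - 1 / n) / 2 ≤ ∑ j ∈ Finset.Ico r n, (1 : ℝ) / j := by
  induction n, hrn using Nat.le_induction with
  | base =>
    have : (r : ℝ) ≠ 0 := by positivity
    simp [this]
  | succ n hn ih =>
    rw [Finset.sum_Ico_succ_top hn]
    have hn0 : 0 < n := hr.trans_le hn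
    have hn' : (0 : ℝ) < n := by exact_mod_cast hn0
    have hr' : (0 : ℝ) < r := by exact_mod_cast hr
    have h := log_succ_div_le hn0
    have h2 : Real.log ((n + 1 : ℕ) / r) = Real.log (n / r) + Real.log ((n + 1 : ℝ) / n) := by
      rw [← Real.log_mul (by positivity) (by positivity)]
      congr 1
      push_cast
      field_simp
    rw [h2]
    push_cast
    linarith

/-- The success probability of Dynkin's algorithm is at least `1 / e`. -/
lemma inv_exp_le_success {n : ℕ} (hr : 0 < ⌊(n : ℝ) / Real.exp 1⌋₊) :
    1 / Real.exp 1 ≤ (⌊(n : ℝ) / Real.exp 1⌋₊ : ℝ) / n *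
      ∑ j ∈ Finset.Ico ⌊(n : ℝ) / Real.exp 1⌋₊ n, (1 : ℝ) / j := by
  have he1 := Real.exp_one_gt_d9
  have he2 := Real.exp_one_lt_d9
  set e := Real.exp 1 with he
  have he0 : 0 < e := by positivity
  have hr1 : (1 : ℝ) ≤ n / e := by
    by_contra h
    rw [Nat.floor_eq_zero.2 (not_le.1 h)] at hr
    exact hr.false
  rw [le_div_iff₀ he0] at hr1
  have hn3 : 3 ≤ n := by
    by_contra h
    have : (n : ℝ) ≤ 2 := by exact_mod_cast (by omega : n ≤ 2)
    linarith
  have hinv : 1 / e ≤ 0.368 := by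
    rw [div_le_iff₀ he0]
    linarith
  -- The asymptotic estimate below needs `e / n ≤ 0.31`, which fails at 8; the floor is 1 for `n`
  -- from 3 to 5 and 2 from 6 to 8.
  rcases le_or_gt n 8 with hn | hn
  · have hfl (m : ℕ) (h1 : m * e ≤ n) (h2 : n < (m + 1) * e) : ⌊(n : ℝ) / e⌋₊ = m := by
      rw [Nat.floor_eq_iff (by positivity), le_div_iff₀ he0, div_lt_iff₀ he0]
      exact ⟨h1, h2⟩
    refine hinv.trans ?_
    rcases le_or_gt n 5 with hn' | hn'
    · rw [hfl 1 (by push_cast; linarith)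
        (by have : (n : ℝ) ≤ 5 := by exact_mod_cast hn'
            push_cast; linarith)]
      interval_cases n <;> norm_num [Finset.sum_Ico_succ_top]
    · rw [hfl 2 (by have : (6 : ℝ) ≤ n := by exact_mod_cast hn'
                    push_cast; linarith)
        (by have : (n : ℝ) ≤ 8 := by exact_mod_cast hn
            push_cast; linarith)]
      interval_cases n <;> norm_num [Finset.sum_Ico_succ_top]
  · have hn9 : (9 : ℝ) ≤ n := by exact_mod_cast hn
    have hn0 : (0 : ℝ) < n := by linarith
    have hle : (⌊(n : ℝ) / e⌋₊ : ℝ) ≤ n / e := Nat.floor_le (by positivity)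
    have hlt : (n : ℝ) / e < ⌊(n : ℝ) / e⌋₊ + 1 := Nat.lt_floor_add_one _
    set r := ⌊(n : ℝ) / e⌋₊ with hrdef
    have hr0 : (0 : ℝ) < r := by exact_mod_cast hr
    have hlen : (n : ℝ) / e ≤ n := div_le_self hn0.le (by linarith)
    have hrn : r ≤ n := by exact_mod_cast hle.trans hlen
    have hsum := log_div_add_le_sum_Ico hr hrn
    have hlog : 2 - r * e / n ≤ Real.log (n / r) := by
      have h1 : Real.log (n / r) = 1 - Real.log (r * e / n) := by
        rw [Real.log_div hn0.ne' hr0.ne', Real.log_div (by positivity) hn0.ne',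
          Real.log_mul hr0.ne' he0.ne', he, Real.log_exp]
        ring
      have h2 := Real.log_le_sub_one_of_pos (x := r * e / n) (by positivity)
      linarith
    have hmain : (n : ℝ) / e ≤ r * ∑ j ∈ Finset.Ico r n, (1 : ℝ) / j := by
      refine le_trans ?_ (mul_le_mul_of_nonneg_left (le_trans (add_le_add_left hlog _) hsum) hr0.le)
      -- Rounding by `δ < 1` costs only the second-order term `δ ^ 2 * e / n ≤ 0.31`, while the
      -- trapezoidal gain `(1 - r / n) / 2` is at least 0.316.
      obtain ⟨δ, hδ⟩ : ∃ δ, δ = (n : ℝ) / e - r := ⟨_, rfl⟩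
      have hδ0 : 0 ≤ δ := by linarith
      have hδ1 : δ < 1 := by linarith
      have hr' : (r : ℝ) = n / e - δ := by linarith
      have h1 : (r : ℝ) * (2 - r * e / n + (1 / r - 1 / n) / 2)
          = n / e - δ ^ 2 * e / n + (1 - r / n) / 2 := by
        have : (r : ℝ) * (1 / r - 1 / n) = 1 - r / n := by field_simp
        have h3 : (r : ℝ) * (2 - r * e / n) = n / e - δ ^ 2 * e / n := by
          rw [hr']; field_simp; ring
        linear_combination h3 + this / 2
      rw [h1]
      have h4 : (r : ℝ) / n ≤ 0.368 := by
        refine le_trans ?_ hinv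
        rw [div_le_div_iff₀ hn0 he0]
        rw [le_div_iff₀ he0] at hle
        linarith
      have h5 : δ ^ 2 * e / n ≤ 0.31 := by
        rw [div_le_iff₀ hn0]
        nlinarith
      linarith
    rw [div_mul_eq_mul_div, le_div_iff₀ hn0, div_mul_eq_mul_div, one_mul]
    exact hmain

/-! ### A sufficient condition for Dynkin's rule to succeed. -/

section Dynkin

variable {Ω : Type*} [LinearOrder Ω] {f : Finset Ω → ℝ}

lemma dynkin_eq_singleton {l : List Ω} (hl : l.Nodup) {b : Ω}
    (hb : ∀ x, dynkinKey f x ≤ dynkinKey f b) {j : ℕ} (hj : j < l.length) (hjb : l[j] = b)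
    (hrj : dynkinPhase l.length ≤ j)
    (h : ∀ a ∈ (l.take j).drop (dynkinPhase l.length),
      ∃ y ∈ l.take (dynkinPhase l.length), dynkinKey f a ≤ dynkinKey f y) :
    dynkin f l = {b} := by
  set r := dynkinPhase l.length with hr
  have hbm : b ∈ dynkin f l := by
    rw [mem_dynkin, ← hr, List.find?_eq_some_iff_append]
    refine ⟨?_, (l.take j).drop r, l.drop (j + 1), ?_, ?_⟩
    · rw [decide_eq_true_eq]
      intro y hy
      refine lt_of_le_of_ne (hb y) fun hyb => ?_
      obtain ⟨i, hi, hi'⟩ := List.mem_take_iff_getElem.1 hy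
      have h1 : l[i]'(lt_min_iff.1 hi).2 = l[j] := by
        rw [hi', hjb]
        exact dynkinKey_injective f hyb
      have := (hl.getElem_inj_iff).1 h1
      have := (lt_min_iff.1 hi).1
      omega
    · rw [← hjb, List.cons_getElem_drop_succ]
      conv_lhs => rw [← List.take_append_drop j l]
      rw [List.drop_append_of_le_length (by rw [List.length_take]; omega)]
    · intro a ha
      obtain ⟨y, hy, hay⟩ := h a ha
      simp only [Bool.not_eq_true', decide_eq_false_iff_not, not_forall]
      exact ⟨y, hy, hay.not_gt⟩
  exact Finset.Subset.antisymm (fun x hx => Finset.mem_singleton.2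
    (Finset.card_le_one.1 (dynkin_card_le f l) x hx b hbm)) (Finset.singleton_subset_iff.2 hbm)

end Dynkin

/-! ### Counting enumerations by symmetry. -/

section Counting

variable {ι Ω K : Type*} [Fintype ι] [DecidableEq ι] [Fintype Ω] [DecidableEq Ω] [LinearOrder K]

lemma card_equiv_le_card_filter_apply_eq (b : Ω) (q : ι) :
    Fintype.card (ι ≃ Ω) ≤
      Fintype.card ι * (Finset.univ.filter fun σ : ι ≃ Ω => σ q = b).card := by
  have h1 (p : ι) : (Finset.univ.filter fun σ : ι ≃ Ω => σ p = b).card =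
      (Finset.univ.filter fun σ : ι ≃ Ω => σ q = b).card := by
    refine Finset.card_equiv (Equiv.equivCongr (Equiv.swap p q) (Equiv.refl Ω)) fun σ => ?_
    simp [Equiv.equivCongr]
  have h2 : (Finset.univ : Finset (ι ≃ Ω)) ⊆
      Finset.univ.biUnion fun p => Finset.univ.filter fun σ : ι ≃ Ω => σ p = b := fun σ _ => by
    simpa using σ.surjective b
  have h3 := (Finset.card_le_card h2).trans Finset.card_biUnion_le
  rwa [Finset.sum_congr rfl fun p _ => h1 p, Finset.sum_const, smul_eq_mul, Finset.card_univ,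
    Finset.card_univ] at h3

/-- The enumerations with `b` at `q` whose entry at `p` is the largest of those in `P`. -/
def maxAt (κ : Ω → K) (b : Ω) (q : ι) (P : Finset ι) (p : ι) : Finset (ι ≃ Ω) :=
  Finset.univ.filter fun σ => σ q = b ∧ ∀ i ∈ P, κ (σ i) ≤ κ (σ p)

lemma card_filter_le_card_maxAt (κ : Ω → K) (b : Ω) {q : ι} {P : Finset ι} (hq : q ∉ P) {p : ι}
    (hp : p ∈ P) : (Finset.univ.filter fun σ : ι ≃ Ω => σ q = b).card ≤
      P.card * (maxAt κ b q P p).card := by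
  -- Swapping two positions of `P` fixes `q` and permutes `P`, so the maximum is equally likely at
  -- each position; only covering is needed for the lower bound.
  have h1 : ∀ p' ∈ P, (maxAt κ b q P p').card = (maxAt κ b q P p).card := fun p' hp' => by
    have hsw (i : ι) : Equiv.swap p' p i ∈ P ↔ i ∈ P := by
      rcases eq_or_ne i p' with rfl | h1
      · simp [hp, hp']
      rcases eq_or_ne i p with rfl | h2
      · simp [hp, hp']
      · rw [Equiv.swap_apply_of_ne_of_ne h1 h2]
    refine Finset.card_equiv (Equiv.equivCongr (Equiv.swap p' p) (Equiv.refl Ω)) fun σ => ?_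
    have hq' : Equiv.swap p' p q = q := Equiv.swap_apply_of_ne_of_ne
      (fun h => hq (h ▸ hp')) (fun h => hq (h ▸ hp))
    have ha (i : ι) : (Equiv.equivCongr (Equiv.swap p' p) (Equiv.refl Ω)) σ i =
        σ (Equiv.swap p' p i) := by simp [Equiv.equivCongr]
    simp only [maxAt, Finset.mem_filter, Finset.mem_univ, true_and, ha, hq',
      Equiv.swap_apply_right]
    refine and_congr_right fun _ => ⟨fun h i hi => h _ ((hsw i).2 hi), fun h i hi => ?_⟩
    simpa using h _ ((hsw i).2 hi)
  have h2 : (Finset.univ.filter fun σ : ι ≃ Ω => σ q = b) ⊆ P.biUnion fun p => maxAt κ b q P p := by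
    intro σ hσ
    obtain ⟨p', hp', h⟩ := P.exists_max_image (fun i => κ (σ i)) ⟨p, hp⟩
    simp only [Finset.mem_filter, Finset.mem_univ, true_and] at hσ
    simp only [Finset.mem_biUnion, maxAt, Finset.mem_filter, Finset.mem_univ, true_and]
    exact ⟨p', hp', hσ, h⟩
  have h3 := (Finset.card_le_card h2).trans Finset.card_biUnion_le
  rwa [Finset.sum_congr rfl h1, Finset.sum_const, smul_eq_mul] at h3

lemma disjoint_maxAt {κ : Ω → K} (hκ : Function.Injective κ) (b : Ω) {q q' : ι}
    {P P' : Finset ι} {p p' : ι} (hp : p ∈ P) (hp' : p' ∈ P') (hne : (q, p) ≠ (q', p'))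
    (hP : q = q' → P = P') :
    Disjoint (maxAt κ b q P p) (maxAt κ b q' P' p') := by
  rw [Finset.disjoint_left]
  intro σ h h'
  simp only [maxAt, Finset.mem_filter, Finset.mem_univ, true_and] at h h'
  obtain rfl : q = q' := σ.injective (h.1.trans h'.1.symm)
  obtain rfl := hP rfl
  exact hne (Prod.ext rfl (σ.injective (hκ (le_antisymm (h'.2 p hp) (h.2 p' hp')))))

end Counting

/-! ### The success probability and value of Dynkin's rule. -/

section DynkinValue

variable {Ω : Type*} [Fintype Ω] [LinearOrder Ω] {f : Finset Ω → ℝ}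

lemma factorial_le_exp_mul_card (f : Finset Ω → ℝ) {b : Ω}
    (hb : ∀ x, dynkinKey f x ≤ dynkinKey f b) :
    ((Fintype.card Ω).factorial : ℝ) / Real.exp 1 ≤
      (Finset.univ.filter fun σ : Fin (Fintype.card Ω) ≃ Ω =>
        dynkin f (List.ofFn σ) = {b}).card := by
  set n := Fintype.card Ω with hn
  have hn0 : 0 < n := Fintype.card_pos_iff.2 ⟨b⟩
  have hn0' : (0 : ℝ) < n := by exact_mod_cast hn0
  have hcard : Fintype.card (Fin n ≃ Ω) = n.factorial := by
    rw [Fintype.card_equiv (Fintype.equivFin Ω).symm, Fintype.card_fin]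
  set r := dynkinPhase n with hr
  set G := Finset.univ.filter fun σ : Fin n ≃ Ω => dynkin f (List.ofFn σ) = {b} with hG
  have hbase (q : Fin n) : (n.factorial : ℝ) / n ≤
      (Finset.univ.filter fun σ : Fin n ≃ Ω => σ q = b).card := by
    have h := card_equiv_le_card_filter_apply_eq b q
    rw [hcard, Fintype.card_fin] at h
    rw [div_le_iff₀' hn0']
    exact_mod_cast h
  have hfac : (0 : ℝ) < n.factorial := by exact_mod_cast Nat.factorial_pos _
  -- With an empty sample the first element is selected, and it is the best one with probability `1
  -- / n`, where `n < e`.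
  rcases Nat.eq_zero_or_pos r with hr0 | hr0
  · have hne : (n : ℝ) < Real.exp 1 := by
      have := Nat.floor_eq_zero.1 (hr.symm.trans hr0)
      rwa [div_lt_one (Real.exp_pos 1)] at this
    refine ((div_le_div_of_nonneg_left hfac.le hn0' hne.le).trans (hbase ⟨0, hn0⟩)).trans ?_
    norm_cast
    refine Finset.card_le_card fun σ hσ => ?_
    simp only [hG, Finset.mem_filter, Finset.mem_univ, true_and] at hσ ⊢
    refine dynkin_eq_singleton (List.nodup_ofFn.2 σ.injective) hb (j := 0) (by simpa) (by simpa)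
      ?_ (by simp)
    rw [List.length_ofFn, ← hr, hr0]
  · set P : Fin n → Finset (Fin n) := fun q => Finset.univ.filter fun i => (i : ℕ) < q with hP
    -- Success is split by the position `q ≥ r` of the best element and the position `p < r` of the
    -- largest of its predecessors. Each pair has probability at least `1 / (n q)`, which sums to `r
    -- / n` times the sum of the `1 / q`.
    set I : Finset (Fin n × Fin n) := (Finset.univ.filter fun q : Fin n => r ≤ (q : ℕ)) ×ˢ
      (Finset.univ.filter fun p : Fin n => (p : ℕ) < r) with hI
    have hmemI : ∀ x ∈ I, r ≤ (x.1 : ℕ) ∧ (x.2 : ℕ) < r := fun x hx => by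
      simpa [hI] using hx
    have hmemP : ∀ x ∈ I, x.2 ∈ P x.1 := fun x hx => by
      have := hmemI x hx
      simp only [hP, Finset.mem_filter, Finset.mem_univ, true_and]
      omega
    have hsub : (I.biUnion fun x => maxAt (dynkinKey f) b x.1 (P x.1) x.2) ⊆ G := by
      intro σ hσ
      obtain ⟨⟨q, p⟩, hx, hσ⟩ := Finset.mem_biUnion.1 hσ
      have hx' := hmemI _ hx
      simp only [maxAt, hP, Finset.mem_filter, Finset.mem_univ, true_and] at hσ hx'
      simp only [hG, Finset.mem_filter, Finset.mem_univ, true_and]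
      refine dynkin_eq_singleton (List.nodup_ofFn.2 σ.injective) hb (j := q) (by simp)
        (by simpa using hσ.1) (by simpa using hx'.1) fun a ha => ?_
      rw [List.length_ofFn, ← hr] at ha ⊢
      refine ⟨σ p, List.mem_take_iff_getElem.2 ⟨p, by simp [hx'.2], by simp⟩, ?_⟩
      obtain ⟨i, hi, rfl⟩ := List.mem_take_iff_getElem.1 (List.mem_of_mem_drop ha)
      rw [List.getElem_ofFn]
      exact hσ.2 ⟨i, _⟩ (lt_min_iff.1 hi).1
    have hdisj : (I : Set (Fin n × Fin n)).PairwiseDisjoint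
        fun x => maxAt (dynkinKey f) b x.1 (P x.1) x.2 := fun x hx y hy hxy =>
      disjoint_maxAt (dynkinKey_injective f) b (hmemP x hx) (hmemP y hy) hxy fun h => by rw [h]
    have hterm : ∀ x ∈ I, (n.factorial : ℝ) / n * (1 / (x.1 : ℕ)) ≤
        (maxAt (dynkinKey f) b x.1 (P x.1) x.2).card := fun x hx => by
      have h := card_filter_le_card_maxAt (dynkinKey f) b (q := x.1) (P := P x.1) (by simp [hP])
        (hmemP x hx)
      have hPc : (P x.1).card = x.1 := by
        rw [hP, Fin.card_filter_val_lt, min_eq_right x.1.2.le]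
      rw [hPc] at h
      have hq : (0 : ℝ) < (x.1 : ℕ) := by exact_mod_cast hr0.trans_le (hmemI x hx).1
      rw [mul_one_div, div_le_iff₀' hq]
      exact (hbase x.1).trans (by exact_mod_cast h)
    have hle := Finset.card_le_card hsub
    rw [Finset.card_biUnion hdisj] at hle
    have hsum := Finset.sum_le_sum hterm
    have hrn : r ≤ n := by
      have : (n : ℝ) / Real.exp 1 ≤ n := div_le_self hn0'.le (by linarith [Real.exp_one_gt_d9])
      exact (Nat.floor_le_floor this).trans (Nat.floor_natCast n).le
    have hIsum : ∑ x ∈ I, (n.factorial : ℝ) / n * (1 / (x.1 : ℕ)) =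
        n.factorial * ((r : ℝ) / n * ∑ j ∈ Finset.Ico r n, (1 : ℝ) / j) := by
      have hico : ∑ q ∈ Finset.univ.filter (fun q : Fin n => r ≤ (q : ℕ)), (1 : ℝ) / (q : ℕ) =
          ∑ j ∈ Finset.Ico r n, (1 : ℝ) / j := by
        rw [Finset.sum_filter, Fin.sum_univ_eq_sum_range (fun q => if r ≤ q then (1 : ℝ) / q else 0),
          ← Finset.sum_filter]
        congr 1
        ext q
        simp [and_comm]
      rw [hI, Finset.sum_product]
      simp only [Finset.sum_const, nsmul_eq_mul]
      rw [Fin.card_filter_val_lt, min_eq_right hrn, ← hico, Finset.mul_sum, Finset.mul_sum]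
      exact Finset.sum_congr rfl fun q _ => by ring
    rw [hIsum] at hsum
    have hexp := inv_exp_le_success (n := n) hr0
    calc (n.factorial : ℝ) / Real.exp 1 = n.factorial * (1 / Real.exp 1) := by ring
      _ ≤ n.factorial * ((r : ℝ) / n * ∑ j ∈ Finset.Ico r n, (1 : ℝ) / j) :=
        mul_le_mul_of_nonneg_left hexp hfac.le
      _ ≤ _ := hsum
      _ ≤ _ := by exact_mod_cast hle

lemma le_sum_dynkin (hf : IsValuation f) (x : Ω) :
    f {x} / Real.exp 1 ≤ ((Fintype.card Ω).factorial : ℝ)⁻¹ *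
      ∑ σ : Fin (Fintype.card Ω) ≃ Ω, f (dynkin f (List.ofFn σ)) := by
  obtain ⟨b, -, hb⟩ := Finset.univ.exists_max_image (dynkinKey f) ⟨x, Finset.mem_univ x⟩
  have hxb : f {x} ≤ f {b} := by
    rcases Prod.Lex.le_iff.1 (hb x (Finset.mem_univ x)) with h | h
    · exact le_of_lt h
    · exact h.1.le
  have hfac : (0 : ℝ) < (Fintype.card Ω).factorial := by exact_mod_cast Nat.factorial_pos _
  have h := factorial_le_exp_mul_card f fun x => hb x (Finset.mem_univ x)
  have h2 : (Finset.univ.filter fun σ : Fin (Fintype.card Ω) ≃ Ω =>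
      dynkin f (List.ofFn σ) = {b}).card * f {b} ≤
      ∑ σ : Fin (Fintype.card Ω) ≃ Ω, f (dynkin f (List.ofFn σ)) := by
    rw [← nsmul_eq_mul, ← Finset.sum_const]
    refine (Finset.sum_le_sum fun σ hσ => ?_).trans
      (Finset.sum_le_sum_of_subset_of_nonneg (Finset.filter_subset _ _) fun σ _ _ => hf.nonneg _)
    rw [(Finset.mem_filter.1 hσ).2]
  rw [inv_mul_eq_div, le_div_iff₀ hfac]
  refine le_trans ?_ h2
  calc f {x} / Real.exp 1 * (Fintype.card Ω).factorial
      = (Fintype.card Ω).factorial / Real.exp 1 * f {x} := by ring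
    _ ≤ _ := mul_le_mul h hxb (hf.nonneg _) (by positivity)

end DynkinValue

/-! ### Combining the two branches and choosing the constants. -/

section Main

variable {Ω : Type*} [Fintype Ω] [LinearOrder Ω] {k : ℕ} {ρoff ρon : ℝ}
  {Off : (Finset Ω → ℝ) → Finset Ω → PMF (Finset Ω)}
  {On : ℝ → (Finset Ω → ℝ) → List Ω → PMF (Finset Ω)} {f : Finset Ω → ℝ}

/-- The approximation guarantee of `submodularSecretaries`, with the loss in the random split
bounded by the Cauchy–Schwarz inequality. -/
theorem min_mul_opt_le_secretaryValue (hρoff : 1 ≤ ρoff) (hρon : 1 ≤ ρon)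
    (hOff : IsOfflineApprox k ρoff Off) (hOn : IsAdviceApprox k ρon On) (hf : IsValuation f)
    {c : ℝ} (hc : 0 < c) :
    min (1 / (8 * ρoff * ρon) * (1 - 1 / √c)) (1 / (2 * c * Real.exp 1)) * opt f k Finset.univ ≤
      secretaryValue (submodularSecretaries Off On) f := by
  have hO := hf.opt_nonneg k Finset.univ
  rw [secretaryValue_eq]
  simp only [expect_submodularSecretaries, Finset.sum_add_distrib, ← Finset.sum_div, mul_add,
    ← mul_div_assoc]
  have hfac : (0 : ℝ) ≤ ((Fintype.card Ω).factorial : ℝ)⁻¹ := by positivity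
  have hD := mul_nonneg hfac (Finset.sum_nonneg
    fun (σ : Fin (Fintype.card Ω) ≃ Ω) (_ : σ ∈ Finset.univ) => hf.nonneg (dynkin f (List.ofFn σ)))
  have hT := mul_nonneg hfac (Finset.sum_nonneg
    fun (σ : Fin (Fintype.card Ω) ≃ Ω) (_ : σ ∈ Finset.univ) =>
      expect_nonneg (tails Off On f (List.ofFn σ)) hf.nonneg)
  by_cases h : ∀ x, f {x} ≤ opt f k Finset.univ / c
  · refine (mul_le_mul_of_nonneg_right (min_le_left _ _) hO).trans ?_
    have h1 := le_sum_expect_tails hρoff hρon hOff hOn hf hc h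
    have h2 : 1 / (8 * ρoff * ρon) * (1 - 1 / √c) * opt f k Finset.univ =
        (1 - 1 / √c) * opt f k Finset.univ / (4 * ρoff * ρon) / 2 := by
      field_simp
      ring
    linarith
  · push Not at h
    obtain ⟨x, hx⟩ := h
    refine (mul_le_mul_of_nonneg_right (min_le_right _ _) hO).trans ?_
    have h1 := le_sum_dynkin hf x
    have h2 : 1 / (2 * c * Real.exp 1) * opt f k Finset.univ =
        opt f k Finset.univ / c / Real.exp 1 / 2 := by
      field_simp
    have h3 := div_le_div_of_nonneg_right hx.le (Real.exp_pos 1).le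
    linarith

lemma chebyshev_factor_le {c d : ℝ} (hc : 1 ≤ c) (hd : 0 < d) :
    (1 - 1 / d ^ 2) * (1 - d / √c) ≤ 1 - 1 / √c := by
  obtain ⟨s, hs⟩ : ∃ s, s = √c := ⟨_, rfl⟩
  have hs1 : 1 ≤ s := by rw [hs]; exact Real.one_le_sqrt.2 hc
  rw [← hs]
  have hs0 : 0 < s := by linarith
  have hr : 0 ≤ 1 - 1 / s := by rw [sub_nonneg, div_le_one hs0]; exact hs1
  rcases lt_or_ge d 1 with h1 | h1
  · refine le_trans (mul_nonpos_of_nonpos_of_nonneg ?_ ?_) hr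
    · rw [sub_nonpos, one_le_div (by positivity)]
      nlinarith
    · rw [sub_nonneg, div_le_one hs0]
      linarith
  rcases lt_or_ge s d with h2 | h2
  · refine le_trans (mul_nonpos_of_nonneg_of_nonpos ?_ ?_) hr
    · rw [sub_nonneg, div_le_one (by positivity)]
      nlinarith
    · rw [sub_nonpos, one_le_div hs0]
      -- In the remaining range `1 ≤ d ≤ s` the difference of the two sides has a visibly
      -- non-negative numerator.
      exact h2.le
  have h3 : 1 - 1 / s - (1 - 1 / d ^ 2) * (1 - d / s) =
      (d ^ 2 * (d - 1) + (s - d)) / (d ^ 2 * s) := by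
    field_simp
    ring
  have h4 : 0 ≤ (d ^ 2 * (d - 1) + (s - d)) / (d ^ 2 * s) :=
    div_nonneg (add_nonneg (mul_nonneg (sq_nonneg d) (by linarith)) (by linarith)) (by positivity)
  linarith

theorem min_chebyshev_mul_opt_le_secretaryValue (hρoff : 1 ≤ ρoff) (hρon : 1 ≤ ρon)
    (hOff : IsOfflineApprox k ρoff Off) (hOn : IsAdviceApprox k ρon On) (hf : IsValuation f)
    {c d : ℝ} (hc : 1 ≤ c) (hd : 0 < d) :
    min (1 / (8 * ρoff * ρon) * (1 - 1 / d ^ 2) * (1 - d / √c)) (1 / (2 * c * Real.exp 1)) *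
        opt f k Finset.univ ≤ secretaryValue (submodularSecretaries Off On) f := by
  refine le_trans (mul_le_mul_of_nonneg_right (min_le_min_right _ ?_) (hf.opt_nonneg _ _))
    (min_mul_opt_le_secretaryValue hρoff hρon hOff hOn hf (zero_lt_one.trans_le hc))
  rw [mul_assoc]
  exact mul_le_mul_of_nonneg_left (chebyshev_factor_le hc hd) (by positivity)

theorem opt_div_le_secretaryValue (hρoff : 1 ≤ ρoff) (hρoff' : ρoff ≤ 13 / 2)
    (hOff : IsOfflineApprox k ρoff Off) (hOn : IsAdviceApprox k 21 On) (hf : IsValuation f) :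
    opt f k Finset.univ / 1417 ≤ secretaryValue (submodularSecretaries Off On) f := by
  refine le_trans ?_ (min_mul_opt_le_secretaryValue hρoff (by norm_num) hOff hOn hf
    -- This makes `√c = 16`: the splitting branch loses 8 · 6.5 · 21 · 16/15 = 1164.8 and the Dynkin
    -- branch 512e < 1392, both below 1417.
    (c := 256) (by norm_num))
  rw [div_eq_inv_mul]
  refine mul_le_mul_of_nonneg_right (le_min ?_ ?_) (hf.opt_nonneg _ _)
  · have hs : √(256 : ℝ) = 16 := by
      rw [Real.sqrt_eq_iff_mul_self_eq_of_pos] <;> norm_num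
    have h : 1 / (8 * (13 / 2) * 21) ≤ 1 / (8 * ρoff * 21) :=
      one_div_le_one_div_of_le (by positivity) (by linarith)
    rw [hs]
    norm_num at h ⊢
    linarith
  · rw [← one_div]
    exact one_div_le_one_div_of_le (by positivity) (by linarith [Real.exp_one_lt_d9])

end Main

end SubmodSec

theorem mainTheorem6 {Ω : Type*} [Fintype Ω] [LinearOrder Ω] (k : ℕ) (hk : 1 ≤ k)
    (ρoff : ℝ) (hρoff : 1 ≤ ρoff)
    (Off : (Finset Ω → ℝ) → Finset Ω → PMF (Finset Ω))
    (hOff : SubmodSec.IsOfflineApprox k ρoff Off) :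
    (∀ (ρon : ℝ) (On : ℝ → (Finset Ω → ℝ) → List Ω → PMF (Finset Ω)), 1 ≤ ρon →
      SubmodSec.IsAdviceApprox k ρon On →
      SubmodSec.IsSecretaryAlgorithm k (SubmodSec.submodularSecretaries Off On) ∧
      ∀ f : Finset Ω → ℝ, SubmodSec.IsValuation f → ∀ c d : ℝ, 1 ≤ c → 0 < d →
        min (1 / (8 * ρoff * ρon) * (1 - 1 / d ^ 2) * (1 - d / √c)) (1 / (2 * c * Real.exp 1))
            * SubmodSec.opt f k Finset.univ
          ≤ SubmodSec.secretaryValue (SubmodSec.submodularSecretaries Off On) f) ∧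
    SubmodSec.IsSecretaryAlgorithm k
      (SubmodSec.submodularSecretaries Off (SubmodSec.thresholdAdvice k)) ∧
    (∀ f : Finset Ω → ℝ, SubmodSec.IsValuation f → ∀ c d : ℝ, 1 ≤ c → 0 < d →
      min (1 / (8 * ρoff * 21) * (1 - 1 / d ^ 2) * (1 - d / √c)) (1 / (2 * c * Real.exp 1))
          * SubmodSec.opt f k Finset.univ
        ≤ SubmodSec.secretaryValue
            (SubmodSec.submodularSecretaries Off (SubmodSec.thresholdAdvice k)) f) ∧
    (ρoff ≤ 13 / 2 → ∀ f : Finset Ω → ℝ, SubmodSec.IsValuation f →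
      SubmodSec.opt f k Finset.univ / 1417
        ≤ SubmodSec.secretaryValue
            (SubmodSec.submodularSecretaries Off (SubmodSec.thresholdAdvice k)) f) := by
  have hOn := SubmodSec.isAdviceApprox_thresholdAdvice (Ω := Ω) hk
  refine ⟨fun ρon On hρon hOn' =>
    ⟨SubmodSec.isSecretaryAlgorithm_submodularSecretaries hk hOff hOn', fun f hf c d hc hd =>
      SubmodSec.min_chebyshev_mul_opt_le_secretaryValue hρoff hρon hOff hOn' hf hc hd⟩,
    SubmodSec.isSecretaryAlgorithm_submodularSecretaries hk hOff hOn, fun f hf c d hc hd =>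
      SubmodSec.min_chebyshev_mul_opt_le_secretaryValue hρoff (by norm_num) hOff hOn hf hc hd,
    fun h f hf => SubmodSec.opt_div_le_secretaryValue hρoff h hOff hOn hf⟩
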